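/- Let $K\ge 1$ be an integer, let $p\ge 2$ be an even integer, and let $P_X$ be a probability distribution on $\mathbb{R}^K$ whose first $2p$ moments are finite, i.e. $\int \|x\|^{2p}\,dP_X(x)<\infty$. For $n\ge 1$ let $\mathcal I=\{i\in\{1,\dots,n\}^p : i_1\le i_2\le\dots\le i_p\}$, let $X_1,\dots,X_n$ be i.i.d. with law $P_X$, let $(Z_i)_{i\in\mathcal I}$ be i.i.d. $\mathcal N(0,1)$, independent of the $X_j$, and put, for $i\in\mathcal I$, $$Y_i=\sqrt{\frac{(p-1)!}{n^{p-1}}}\sum_{k=1}^K X_{i_1k}X_{i_2k}\cdots X_{i_pk}+Z_i .$$ For $x=(x_1,\dots,x_n)\in(\mathbb{R}^{K})^n$ let $$\mathcal H_n(x;Y)=\sum_{i\in\mathcal I}\frac{(p-1)!}{2n^{p-1}}\Big(\sum_{k=1}^K\prod_{a=1}^p x_{i_ak}\Big)^2-\sum_{i\in\mathcal I}\sqrt{\frac{(p-1)!}{n^{p-1}}}\;Y_i\sum_{k=1}^K\prod_{a=1}^p x_{i_ak},$$ $$\mathcal Z_n(Y)=\int e^{-\mathcal H_n(x;Y)}\prod_{j=1}^n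 dP_X(x_j),\qquad f_n=\frac1n\,\mathbb{E}\ln\mathcal Z_n(Y).$$ Let $\mathcal S_K^+$ be the set of real symmetric positive semidefinite $K\times K$ matrices. For $S\in\mathcal S_K^+$ let $\sqrt S\in\mathcal S_K^+$ be its square root, let $S^{\circ k}$ be its $k$-th entrywise power, and define $$\psi(S)=\mathbb{E}\ln\int dP_X(x)\,\exp\Big(X^{\mathsf T}Sx+\widetilde Z^{\mathsf T}\sqrt S\,x-\tfrac12x^{\mathsf T}Sx\Big),$$ where $X\sim P_X$ and $\widetilde Z\sim\mathcal N(0,I_K)$ are independent, and $$\phi_p(S)=\psi\big(S^{\circ(p-1)}\big)-\frac{p-1}{2p}\sum_{\ell,\ell'=1}^K\big(S^{\circ p}\big)_{\ell\ell'} .$$ Then all the integrals and expectations in the definitions of $f_n$ and $\psi$ converge absolutely, and $$\liminf_{n\to+\infty} f_n\;\ge\;\sup_{S\in\mathcal S_K^+}\phi_p(S).$$ -/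

import Mathlib

open MeasureTheory ProbabilityTheory Filter
open scoped Matrix Nat

noncomputable section

/-- The index set of the observed entries: the tuples `i ∈ [n]^p` with `i_1 ≤ ⋯ ≤ i_p`. -/
abbrev TensorIndex (n p : ℕ) : Type := {i : Fin p → Fin n // Monotone i}

instance instFintypeTensorIndex (n p : ℕ) : Fintype (TensorIndex n p) :=
  Fintype.ofFinite _

/-- The law of a matrix `x ∈ ℝ^{n × K}` whose rows `x_1, …, x_n` are i.i.d. with law `PX`. -/
def prior {K : ℕ} (n : ℕ) (PX : Measure (Fin K → ℝ)) : Measure (Fin n → Fin K → ℝ) :=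
  Measure.pi fun _ => PX

/-- The law of a family of i.i.d. standard normal variables indexed by `ι`. -/
def stdNormal (ι : Type) [Fintype ι] : Measure (ι → ℝ) :=
  Measure.pi fun _ => gaussianReal 0 1

/-- The scaling factor `√((p-1)! / n^{p-1})`, i.e. signal-to-noise ratio `1`. -/
def signalScale (n p : ℕ) : ℝ := √(((p - 1)! : ℝ) / (n : ℝ) ^ (p - 1))

/-- The entry `∑_k x_{i_1 k} ⋯ x_{i_p k}` of the tensor `∑_k x_{⋅,k}^{⊗ p}`. -/
def tensorEntry {n p K : ℕ} (x : Fin n → Fin K → ℝ) (i : TensorIndex n p) : ℝ :=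
  ∑ k, ∏ a, x (i.1 a) k

/-- The observations `Y_i` produced by the signal `X` and the noise `Z`. -/
def observation {n p K : ℕ} (X : Fin n → Fin K → ℝ) (Z : TensorIndex n p → ℝ) :
    TensorIndex n p → ℝ :=
  fun i => signalScale n p * tensorEntry X i + Z i

/-- The Hamiltonian `H_n(x ; Y)`. -/
def hamiltonian {n p K : ℕ} (x : Fin n → Fin K → ℝ) (Y : TensorIndex n p → ℝ) : ℝ :=
  (∑ i : TensorIndex n p,
      ((p - 1)! : ℝ) / (2 * (n : ℝ) ^ (p - 1)) * tensorEntry x i ^ 2)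
    - ∑ i : TensorIndex n p, signalScale n p * Y i * tensorEntry x i

/-- The normalization factor `Z_n(Y) = ∫ exp(-H_n(x ; Y)) ∏_j dP_X(x_j)`. -/
def partitionFunction {n p K : ℕ} (PX : Measure (Fin K → ℝ)) (Y : TensorIndex n p → ℝ) : ℝ :=
  ∫ x, Real.exp (-hamiltonian x Y) ∂(prior n PX)

/-- The averaged free entropy `f_n = n⁻¹ 𝔼 ln Z_n(Y)`, where `ω = (X, Z)`. -/
def freeEntropy {K : ℕ} (p : ℕ) (PX : Measure (Fin K → ℝ)) (n : ℕ) : ℝ :=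
  1 / (n : ℝ) *
    ∫ ω, Real.log (partitionFunction PX (observation ω.1 ω.2))
      ∂((prior n PX).prod (stdNormal (TensorIndex n p)))

/-- The `k`-th Hadamard (entrywise) power `S^{∘k}`. -/
def hadamardPow {K : ℕ} (S : Matrix (Fin K) (Fin K) ℝ) (k : ℕ) : Matrix (Fin K) (Fin K) ℝ :=
  S.map fun s => s ^ k

section
open scoped MatrixOrder Matrix.Norms.L2Operator

/-- The positive semidefinite square root of a positive semidefinite matrix. -/
def psdSqrt {K : ℕ} (S : Matrix (Fin K) (Fin K) ℝ) : Matrix (Fin K) (Fin K) ℝ :=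
  CFC.sqrt S

end

/-- The exponential weight `exp(Xᵀ S x + Z̃ᵀ √S x - ½ xᵀ S x)`. -/
def scalarWeight {K : ℕ} (S : Matrix (Fin K) (Fin K) ℝ) (X Z x : Fin K → ℝ) : ℝ :=
  Real.exp (X ⬝ᵥ (S *ᵥ x) + Z ⬝ᵥ (psdSqrt S *ᵥ x) - 1 / 2 * (x ⬝ᵥ (S *ᵥ x)))

/-- The normalization factor `∫ dP_X(x) exp(Xᵀ S x + Z̃ᵀ √S x - ½ xᵀ S x)`. -/
def scalarPartition {K : ℕ} (PX : Measure (Fin K → ℝ)) (S : Matrix (Fin K) (Fin K) ℝ)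
    (X Z : Fin K → ℝ) : ℝ :=
  ∫ x, scalarWeight S X Z x ∂PX

/-- The function `ψ(S)`, the average over `ω = (X, Z̃)` of the logarithm of the normalization
factor, for positive semidefinite `S`. -/
def psi {K : ℕ} (PX : Measure (Fin K → ℝ)) (S : Matrix (Fin K) (Fin K) ℝ) : ℝ :=
  ∫ ω, Real.log (scalarPartition PX S ω.1 ω.2) ∂(PX.prod (stdNormal (Fin K)))

/-- The potential `φ_p(S) = ψ(S^{∘(p-1)}) - (p-1)/(2p) ∑_{ℓ,ℓ'} (S^{∘p})_{ℓℓ'}`, for positive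
semidefinite `S`. -/
def potential {K : ℕ} (p : ℕ) (PX : Measure (Fin K → ℝ)) (S : Matrix (Fin K) (Fin K) ℝ) : ℝ :=
  psi PX (hadamardPow S (p - 1))
    - ((p : ℝ) - 1) / (2 * (p : ℝ)) * ∑ l, ∑ l', hadamardPow S p l l'

end

/-! The bound holds at every size `n ≥ 1`, with no error term; the liminf follows at once. It comes
from comparing two Gaussian channels that observe the same signal `x`: the tensor channel, and the
vector channel `√T x_j + noise` with `T = S^{∘(p-1)}`, whose mean log-evidence is `n ψ(T)`.

For a channel with signal `u(x)` and strengths `v`, let `D(v)` be the relative entropy of the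
observation with respect to pure noise. Formally, its derivative in a direction `a` is `½ 𝔼 ∑ a_i
⟨u_i⟩²`, the bracket being the posterior mean. Written with two independent posterior replicas, `∑
a_i ⟨u_i⟩²` is the mean of `∑ a_i u_i(x) u_i(x')`. Hence a pointwise bound `∑ (v₁ - v₀)_i u_i(x)
u_i(x') ≥ -c` for all pairs `x, x'` gives `D(v₀) ≤ D(v₁) + c/2`: this is
`channelEntropy_le_of_kernel_le`. No derivative is taken: the path is cut into `m` small steps, the
chain rule `channelEntropy_add` isolates each step, and the two bounds
`half_sum_sq_mean_le_channelEntropy` and `channelEntropy_le` control it up to an error `O(1/m²)`.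

It remains to compare kernels (`kernel_le`). With the overlaps `Q_{kk'} = n⁻¹ ∑_j x_{jk} x'_{jk'}`,
the vector kernel is `n ∑ S_{kk'}^{p-1} Q_{kk'}`, and the suitably weighted tensor kernel is `(n/p)
∑ Q_{kk'}^p`. For even `p`, convexity of `q ↦ q^p` puts its graph above the tangent at `S_{kk'}`, so
the former exceeds the latter by at most `n (p-1)/p ∑ S_{kk'}^p`; half of this is `n` times the
correction in the potential. The weights on sorted tuples are at most `1`, and lowering strengths
only lowers `D`.

The comparison needs bounded signals. Truncation of the rows and dominated convergence, using the
`2p` moments, remove this restriction. -/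

open scoped NNReal

/-! ### Gaussian measures, shifts and the Cameron–Martin formula -/

/-- The centered Gaussian measure on `ℝ^ι` with independent coordinates of variances `v i`. -/
noncomputable def diagGaussian {ι : Type*} [Fintype ι] (v : ι → ℝ≥0) : Measure (ι → ℝ) :=
  Measure.pi fun i => gaussianReal 0 (v i)

instance {ι : Type*} [Fintype ι] (v : ι → ℝ≥0) : IsProbabilityMeasure (diagGaussian v) := by
  unfold diagGaussian; infer_instance

/-- The likelihood ratio of the shift of `diagGaussian v` by the vector `v * c`. -/
noncomputable def gaussianShift {ι : Type*} [Fintype ι] (v : ι → ℝ≥0) (c y : ι → ℝ) : ℝ :=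
  Real.exp (∑ i, (c i * y i - v i * c i ^ 2 / 2))

section
variable {ι : Type*} [Fintype ι]

lemma gaussianShift_pos (v : ι → ℝ≥0) (c y : ι → ℝ) : 0 < gaussianShift v c y := Real.exp_pos _

/-- Scaling the shift by the variance keeps the formula valid at `v = 0`, where both sides are the
Dirac mass at `0`. -/
lemma gaussianReal_eq_withDensity_shift (v : ℝ≥0) (c : ℝ) :
    gaussianReal (v * c) v = (gaussianReal 0 v).withDensity
      fun y => ENNReal.ofReal (Real.exp (c * y - v * c ^ 2 / 2)) := by
  have hm : Measurable fun y : ℝ => ENNReal.ofReal (Real.exp (c * y - v * c ^ 2 / 2)) := by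
    fun_prop
  by_cases hv : v = 0
  · subst hv
    simp only [NNReal.coe_zero, zero_mul, gaussianReal_zero_var]
    ext s hs
    rw [withDensity_apply _ hs, ← lintegral_indicator hs, lintegral_dirac]
    by_cases h0 : (0 : ℝ) ∈ s <;> simp [Measure.dirac_apply' _ hs, h0]
  · rw [gaussianReal_of_var_ne_zero _ hv, gaussianReal_of_var_ne_zero _ hv,
      ← withDensity_mul _ (measurable_gaussianPDF _ _) hm]
    congr 1
    ext y
    have hv' : (v : ℝ) ≠ 0 := by simpa using hv
    simp only [gaussianPDF, gaussianPDFReal, Pi.mul_apply]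
    rw [← ENNReal.ofReal_mul (by positivity), mul_assoc (√_)⁻¹, ← Real.exp_add]
    congr 3
    field_simp
    ring

lemma integrable_gaussianShift (v : ι → ℝ≥0) (c : ι → ℝ) :
    Integrable (gaussianShift v c) (diagGaussian v) := by
  unfold gaussianShift diagGaussian
  simp_rw [Real.exp_sum, Real.exp_sub]
  exact Integrable.fintype_prod (f := fun i y => Real.exp (c i * y) / Real.exp (v i * c i ^ 2 / 2))
    fun i => (integrable_exp_mul_gaussianReal (c i)).div_const _

lemma measurable_gaussianShift (v : ι → ℝ≥0) (c : ι → ℝ) : Measurable (gaussianShift v c) := by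
  unfold gaussianShift; fun_prop

lemma pi_gaussianReal_eq_withDensity (v : ι → ℝ≥0) (c : ι → ℝ) :
    Measure.pi (fun i => gaussianReal (v i * c i) (v i)) =
      (diagGaussian v).withDensity fun y => ENNReal.ofReal (gaussianShift v c y) := by
  refine Measure.pi_eq (μ := fun i => gaussianReal (v i * c i) (v i)) (fun s hs => ?_)
  rw [withDensity_apply _ (MeasurableSet.univ_pi hs), ← ofReal_integral_eq_lintegral_ofReal
    (integrable_gaussianShift v c).integrableOn (ae_of_all _ fun y => (gaussianShift_pos v c y).le),
    ← integral_indicator (MeasurableSet.univ_pi hs)]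
  have h : (Set.univ.pi s).indicator (gaussianShift v c) = fun y => ∏ i,
      (s i).indicator (fun y => Real.exp (c i * y - v i * c i ^ 2 / 2)) (y i) := by
    ext y
    by_cases hy : y ∈ Set.univ.pi s
    · rw [Set.indicator_of_mem hy, gaussianShift, Real.exp_sum]
      exact Finset.prod_congr rfl fun i _ => (Set.indicator_of_mem (hy i trivial)
        fun y => Real.exp (c i * y - v i * c i ^ 2 / 2)).symm
    · rw [Set.indicator_of_notMem hy]
      simp only [Set.mem_pi, Set.mem_univ, forall_const, not_forall] at hy
      obtain ⟨i, hi⟩ := hy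
      exact (Finset.prod_eq_zero (Finset.mem_univ i) (Set.indicator_of_notMem hi _)).symm
  rw [h, diagGaussian, integral_fintype_prod_eq_prod
    (fun i => (s i).indicator (fun y => Real.exp (c i * y - v i * c i ^ 2 / 2))),
    ENNReal.ofReal_prod_of_nonneg]
  · refine Finset.prod_congr rfl fun i _ => ?_
    rw [gaussianReal_eq_withDensity_shift, withDensity_apply _ (hs i), integral_indicator (hs i),
      ofReal_integral_eq_lintegral_ofReal _ (ae_of_all _ fun y => (Real.exp_pos _).le)]
    simp_rw [Real.exp_sub]
    exact ((integrable_exp_mul_gaussianReal (c i)).div_const _).integrableOn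
  · exact fun i _ => integral_nonneg fun y => Set.indicator_nonneg (fun _ _ => (Real.exp_pos _).le) _

/-- The Cameron–Martin formula. -/
lemma map_add_diagGaussian (v : ι → ℝ≥0) (c : ι → ℝ) :
    (diagGaussian v).map (fun z i => v i * c i + z i) =
      (diagGaussian v).withDensity fun y => ENNReal.ofReal (gaussianShift v c y) := by
  rw [← pi_gaussianReal_eq_withDensity, diagGaussian,
    Measure.pi_map_pi (f := fun i z => v i * c i + z) (fun i => by fun_prop)]
  congr 1
  ext1 i
  rw [gaussianReal_map_const_add, zero_add]

lemma integral_gaussianShift_mul (v : ι → ℝ≥0) (c : ι → ℝ) {h : (ι → ℝ) → ℝ} (hh : Measurable h) :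
    ∫ y, gaussianShift v c y * h y ∂(diagGaussian v) =
      ∫ z, h (fun i => v i * c i + z i) ∂(diagGaussian v) := by
  have hφ : Measurable fun (z : ι → ℝ) i => v i * c i + z i := by fun_prop
  rw [← integral_map hφ.aemeasurable
    hh.aestronglyMeasurable, map_add_diagGaussian,
    integral_withDensity_eq_integral_toReal_smul₀
      (measurable_gaussianShift v c).ennreal_ofReal.aemeasurable (by simp)]
  simp [ENNReal.toReal_ofReal (gaussianShift_pos v c _).le]

lemma integral_gaussianShift (v : ι → ℝ≥0) (c : ι → ℝ) :
    ∫ y, gaussianShift v c y ∂(diagGaussian v) = 1 := by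
  simpa using integral_gaussianShift_mul v c (h := fun _ => 1) measurable_const

lemma integrable_eval_diagGaussian (v : ι → ℝ≥0) (i : ι) :
    Integrable (fun y : ι → ℝ => y i) (diagGaussian v) :=
  integrable_comp_eval (f := fun y => y)
    ((memLp_id_gaussianReal' 1 (by simp)).integrable le_rfl)

lemma integral_eval_diagGaussian (v : ι → ℝ≥0) (i : ι) :
    ∫ y, y i ∂(diagGaussian v) = 0 := by
  rw [diagGaussian, integral_eval, integral_id_gaussianReal]

lemma integrable_sq_eval_diagGaussian (v : ι → ℝ≥0) (i : ι) :
    Integrable (fun y : ι → ℝ => y i ^ 2) (diagGaussian v) :=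
  integrable_comp_eval (f := fun y => y ^ 2)
    (memLp_id_gaussianReal' 2 (by simp)).integrable_sq

/-- The semigroup property of the Gaussian measures. -/
lemma map_add_prod_diagGaussian (v w : ι → ℝ≥0) :
    ((diagGaussian v).prod (diagGaussian w)).map (fun y => y.1 + y.2) = diagGaussian (v + w) := by
  have h := (measurePreserving_arrowProdEquivProdArrow ℝ ℝ ι (fun i => gaussianReal 0 (v i))
    (fun i => gaussianReal 0 (w i))).map_eq
  unfold diagGaussian
  rw [← h, Measure.map_map (by fun_prop) (MeasurableEquiv.measurable _)]
  have : ((fun y : (ι → ℝ) × (ι → ℝ) => y.1 + y.2) ∘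
      (MeasurableEquiv.arrowProdEquivProdArrow ℝ ℝ ι)) = fun y i => (y i).1 + (y i).2 := rfl
  rw [this, Measure.pi_map_pi (f := fun i (y : ℝ × ℝ) => y.1 + y.2) (fun i => by fun_prop)]
  congr 1
  ext1 i
  have := gaussianReal_conv_gaussianReal (m₁ := 0) (m₂ := 0) (v₁ := v i) (v₂ := w i)
  rw [add_zero] at this
  exact this

/-- The exponent is additive in the pair (strength, observation), so the sum of two independent
observations is a sufficient statistic. The chain rule rests on this. -/
lemma gaussianShift_add (v w : ι → ℝ≥0) (c y z : ι → ℝ) :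
    gaussianShift (v + w) c (y + z) = gaussianShift v c y * gaussianShift w c z := by
  simp only [gaussianShift, ← Real.exp_add, ← Finset.sum_add_distrib]
  congr 1
  refine Finset.sum_congr rfl fun i _ => ?_
  simp only [Pi.add_apply, NNReal.coe_add]
  ring

lemma integrable_exp_sum_abs (v : ι → ℝ≥0) (c : ℝ) :
    Integrable (fun y : ι → ℝ => Real.exp (c * ∑ i, |y i|)) (diagGaussian v) := by
  unfold diagGaussian
  simp_rw [Finset.mul_sum, Real.exp_sum]
  exact Integrable.fintype_prod (f := fun _ y => Real.exp (c * |y|))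
    fun i => integrable_exp_mul_abs (integrable_exp_mul_gaussianReal c)
      (integrable_exp_mul_gaussianReal (-c))

end

/-! ### Evidence and relative entropy of a channel with bounded signal -/

/-- The density, with respect to `diagGaussian v`, of the law of the observation `v * u(x) + z`
of the signal `u(x)`, `x ∼ P`, in the noise `z ∼ diagGaussian v`. -/
noncomputable def evidence {ι Ω : Type*} [Fintype ι] [MeasurableSpace Ω] (P : Measure Ω)
    (u : Ω → ι → ℝ) (v : ι → ℝ≥0) (y : ι → ℝ) : ℝ :=
  ∫ x, gaussianShift v (u x) y ∂P

/-- The relative entropy of the law of the observation with respect to the law of the noise. -/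
noncomputable def channelEntropy {ι Ω : Type*} [Fintype ι] [MeasurableSpace Ω] (P : Measure Ω)
    (u : Ω → ι → ℝ) (v : ι → ℝ≥0) : ℝ :=
  ∫ y, evidence P u v y * Real.log (evidence P u v y) ∂(diagGaussian v)

section
variable {ι Ω : Type*} [Fintype ι] [MeasurableSpace Ω]

lemma measurable_gaussianShift_comp (v : ι → ℝ≥0) {u : Ω → ι → ℝ} (hu : Measurable u) :
    Measurable fun q : Ω × (ι → ℝ) => gaussianShift v (u q.1) q.2 := by
  unfold gaussianShift; fun_prop

lemma measurable_evidence (P : Measure Ω) [SFinite P] (v : ι → ℝ≥0) {u : Ω → ι → ℝ}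
    (hu : Measurable u) : Measurable (evidence P u v) :=
  (StronglyMeasurable.integral_prod_left' (f := fun q : Ω × (ι → ℝ) => gaussianShift v (u q.1) q.2)
    (measurable_gaussianShift_comp v hu).stronglyMeasurable).measurable

/-- This envelope, uniform in the signal, supplies the domination for the integrals of bounded
signals. -/
lemma gaussianShift_mem_Icc {C : ℝ} (v : ι → ℝ≥0) {c : ι → ℝ} (hc : ∀ i, |c i| ≤ C) (y : ι → ℝ) :
    gaussianShift v c y ∈ Set.Icc (Real.exp (-(C * (∑ i, |y i|) + C ^ 2 * ∑ i, (v i : ℝ))))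
      (Real.exp (C * (∑ i, |y i|) + C ^ 2 * ∑ i, (v i : ℝ))) := by
  unfold gaussianShift
  rw [Set.mem_Icc, Real.exp_le_exp, Real.exp_le_exp, ← abs_le]
  refine (Finset.abs_sum_le_sum_abs _ _).trans ?_
  rw [Finset.mul_sum, Finset.mul_sum, ← Finset.sum_add_distrib]
  refine Finset.sum_le_sum fun i _ => (abs_sub _ _).trans ?_
  have h1 : |c i * y i| ≤ C * |y i| := by
    rw [abs_mul]; exact mul_le_mul_of_nonneg_right (hc i) (abs_nonneg _)
  have h2 : c i ^ 2 ≤ C ^ 2 := sq_le_sq' (abs_le.1 (hc i)).1 (abs_le.1 (hc i)).2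
  have h3 : |(v i : ℝ) * c i ^ 2 / 2| ≤ C ^ 2 * v i := by
    rw [abs_of_nonneg (by positivity)]
    nlinarith [(v i).coe_nonneg, mul_le_mul_of_nonneg_left h2 (v i).coe_nonneg,
      mul_nonneg (v i).coe_nonneg (sq_nonneg C)]
  exact add_le_add h1 h3

lemma integrable_gaussianShift_prior {P : Measure Ω} [IsFiniteMeasure P] {u : Ω → ι → ℝ}
    (hu : Measurable u) {C : ℝ} (hC : ∀ x i, |u x i| ≤ C) (v : ι → ℝ≥0) (y : ι → ℝ) :
    Integrable (fun x => gaussianShift v (u x) y) P := by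
  refine Integrable.of_bound (by unfold gaussianShift; fun_prop)
    (Real.exp (C * (∑ i, |y i|) + C ^ 2 * ∑ i, (v i : ℝ))) (ae_of_all _ fun x => ?_)
  rw [Real.norm_of_nonneg (gaussianShift_pos _ _ _).le]
  exact (gaussianShift_mem_Icc v (hC x) y).2

lemma evidence_mem_Icc {P : Measure Ω} [IsProbabilityMeasure P] {u : Ω → ι → ℝ}
    (hu : Measurable u) {C : ℝ} (hC : ∀ x i, |u x i| ≤ C) (v : ι → ℝ≥0) (y : ι → ℝ) :
    evidence P u v y ∈ Set.Icc (Real.exp (-(C * (∑ i, |y i|) + C ^ 2 * ∑ i, (v i : ℝ))))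
      (Real.exp (C * (∑ i, |y i|) + C ^ 2 * ∑ i, (v i : ℝ))) := by
  have hi := integrable_gaussianShift_prior (P := P) hu hC v y
  constructor
  · simpa [evidence] using integral_mono (integrable_const _) hi
      fun x => (gaussianShift_mem_Icc v (hC x) y).1
  · simpa [evidence] using integral_mono hi (integrable_const _)
      fun x => (gaussianShift_mem_Icc v (hC x) y).2

lemma evidence_pos {P : Measure Ω} [IsProbabilityMeasure P] {u : Ω → ι → ℝ}
    (hu : Measurable u) {C : ℝ} (hC : ∀ x i, |u x i| ≤ C) (v : ι → ℝ≥0) (y : ι → ℝ) :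
    0 < evidence P u v y :=
  (Real.exp_pos _).trans_le (evidence_mem_Icc hu hC v y).1

lemma abs_log_evidence_le {P : Measure Ω} [IsProbabilityMeasure P] {u : Ω → ι → ℝ}
    (hu : Measurable u) {C : ℝ} (hC : ∀ x i, |u x i| ≤ C) (v : ι → ℝ≥0) (y : ι → ℝ) :
    |Real.log (evidence P u v y)| ≤ C * (∑ i, |y i|) + C ^ 2 * ∑ i, (v i : ℝ) := by
  have h := evidence_mem_Icc (P := P) hu hC v y
  have hp := evidence_pos (P := P) hu hC v y
  exact abs_le.2 ⟨(Real.le_log_iff_exp_le hp).2 h.1, (Real.log_le_iff_le_exp hp).2 h.2⟩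

lemma abs_evidence_mul_log_le {P : Measure Ω} [IsProbabilityMeasure P] {u : Ω → ι → ℝ}
    (hu : Measurable u) {C : ℝ} (hC : ∀ x i, |u x i| ≤ C) (v : ι → ℝ≥0) (y : ι → ℝ) :
    |evidence P u v y * Real.log (evidence P u v y)| ≤
      Real.exp (2 * C ^ 2 * ∑ i, (v i : ℝ)) * Real.exp (2 * C * ∑ i, |y i|) := by
  have h := evidence_mem_Icc (P := P) hu hC v y
  have h2 := abs_log_evidence_le (P := P) hu hC v y
  rw [abs_mul, abs_of_pos (evidence_pos hu hC v y), ← Real.exp_add]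
  calc _ ≤ _ := mul_le_mul h.2 (h2.trans ((Real.add_one_le_exp (C * (∑ i, |y i|) +
        C ^ 2 * ∑ i, (v i : ℝ))).trans' (by linarith))) (abs_nonneg _) (Real.exp_pos _).le
    _ = _ := by rw [← Real.exp_add]; ring_nf

lemma integrable_of_le_exp_sum_abs {v : ι → ℝ≥0} {h : (ι → ℝ) → ℝ} (hm : Measurable h) {A c : ℝ}
    (hb : ∀ y, |h y| ≤ A * Real.exp (c * ∑ i, |y i|)) : Integrable h (diagGaussian v) :=
  ((integrable_exp_sum_abs v c).const_mul A).mono' hm.aestronglyMeasurable (ae_of_all _ hb)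

lemma integrable_evidence_mul_log {P : Measure Ω} [IsProbabilityMeasure P] {u : Ω → ι → ℝ}
    (hu : Measurable u) {C : ℝ} (hC : ∀ x i, |u x i| ≤ C) (v w : ι → ℝ≥0) :
    Integrable (fun y => evidence P u v y * Real.log (evidence P u v y)) (diagGaussian w) := by
  have := measurable_evidence P v hu
  exact integrable_of_le_exp_sum_abs (by fun_prop) (abs_evidence_mul_log_le hu hC v)

lemma integrable_gaussianShift_mul_prod {P : Measure Ω} [IsProbabilityMeasure P] {u : Ω → ι → ℝ}
    (hu : Measurable u) {C : ℝ} (hC : ∀ x i, |u x i| ≤ C) (v : ι → ℝ≥0) {h : (ι → ℝ) → ℝ}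
    (hm : Measurable h) {A c : ℝ} (hb : ∀ y, |h y| ≤ A * Real.exp (c * ∑ i, |y i|)) :
    Integrable (fun q : Ω × (ι → ℝ) => gaussianShift v (u q.1) q.2 * h q.2)
      (P.prod (diagGaussian v)) := by
  have h1 : Integrable (fun q : Ω × (ι → ℝ) => (1 : ℝ) *
      (Real.exp (C ^ 2 * ∑ i, (v i : ℝ)) * A * Real.exp ((C + c) * ∑ i, |q.2 i|)))
      (P.prod (diagGaussian v)) :=
    Integrable.mul_prod (integrable_const _) ((integrable_exp_sum_abs v (C + c)).const_mul _)
  refine h1.mono' ((measurable_gaussianShift_comp v hu).mul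
    (hm.comp measurable_snd)).aestronglyMeasurable (ae_of_all _ fun q => ?_)
  rw [Real.norm_eq_abs, abs_mul, abs_of_pos (gaussianShift_pos _ _ _)]
  calc _ ≤ _ := mul_le_mul (gaussianShift_mem_Icc v (hC q.1) q.2).2 (hb q.2) (abs_nonneg _)
        (Real.exp_pos _).le
    _ = _ := by rw [Real.exp_add, add_mul C c, Real.exp_add]; ring

lemma integrable_evidence_mul {P : Measure Ω} [IsProbabilityMeasure P] {u : Ω → ι → ℝ}
    (hu : Measurable u) {C : ℝ} (hC : ∀ x i, |u x i| ≤ C) (v : ι → ℝ≥0) {h : (ι → ℝ) → ℝ}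
    (hm : Measurable h) {A c : ℝ} (hb : ∀ y, |h y| ≤ A * Real.exp (c * ∑ i, |y i|)) :
    Integrable (fun y => evidence P u v y * h y) (diagGaussian v) := by
  have := (integrable_gaussianShift_mul_prod (P := P) hu hC v hm hb).integral_prod_right
  simpa only [integral_mul_const, evidence] using this

/-- Fubini and Cameron–Martin: weighting the noise by the evidence produces the law of the
observation. -/
lemma integral_evidence_mul_eq_integral_gaussianShift {P : Measure Ω} [IsProbabilityMeasure P]
    {u : Ω → ι → ℝ}
    (hu : Measurable u) {C : ℝ} (hC : ∀ x i, |u x i| ≤ C) (v : ι → ℝ≥0) {h : (ι → ℝ) → ℝ}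
    (hm : Measurable h) {A c : ℝ} (hb : ∀ y, |h y| ≤ A * Real.exp (c * ∑ i, |y i|)) :
    ∫ y, evidence P u v y * h y ∂(diagGaussian v) =
      ∫ x, ∫ z, h (fun i => v i * u x i + z i) ∂(diagGaussian v) ∂P := by
  simp_rw [← integral_gaussianShift_mul v _ hm]
  rw [integral_integral_swap (integrable_gaussianShift_mul_prod (P := P) hu hC v hm hb)]
  simp_rw [integral_mul_const]
  rfl

lemma integrable_evidence {P : Measure Ω} [IsProbabilityMeasure P] {u : Ω → ι → ℝ}
    (hu : Measurable u) {C : ℝ} (hC : ∀ x i, |u x i| ≤ C) (v : ι → ℝ≥0) :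
    Integrable (evidence P u v) (diagGaussian v) := by
  simpa using integrable_evidence_mul (P := P) hu hC v (h := fun _ => 1) measurable_const
    (A := 1) (c := 0) (by simp)

lemma integral_evidence {P : Measure Ω} [IsProbabilityMeasure P] {u : Ω → ι → ℝ}
    (hu : Measurable u) {C : ℝ} (hC : ∀ x i, |u x i| ≤ C) (v : ι → ℝ≥0) :
    ∫ y, evidence P u v y ∂(diagGaussian v) = 1 := by
  simpa using integral_evidence_mul_eq_integral_gaussianShift (P := P) hu hC v (h := fun _ => 1)
    measurable_const (A := 1) (c := 0) (by simp)

lemma integrable_coord {ι Ω : Type*} [MeasurableSpace Ω] {P : Measure Ω} [IsFiniteMeasure P] {u : Ω → ι → ℝ}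
    (hu : Measurable u) {C : ℝ} (hC : ∀ x i, |u x i| ≤ C) (i : ι) :
    Integrable (fun x => u x i) P :=
  Integrable.of_bound (by fun_prop) C (ae_of_all _ fun x => hC x i)

lemma abs_mean_le {ι Ω : Type*} [MeasurableSpace Ω] {P : Measure Ω} [IsProbabilityMeasure P] {u : Ω → ι → ℝ}
    {C : ℝ} (hC : ∀ x i, |u x i| ≤ C) (i : ι) : |∫ x, u x i ∂P| ≤ C := by
  simpa using norm_integral_le_of_norm_le_const (μ := P) (f := fun x => u x i)
    (ae_of_all _ fun x => hC x i)

lemma abs_log_gaussianShift_le {C : ℝ} (v : ι → ℝ≥0) {c : ι → ℝ} (hc : ∀ i, |c i| ≤ C)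
    (y : ι → ℝ) : |Real.log (gaussianShift v c y)| ≤
      Real.exp (C ^ 2 * ∑ i, (v i : ℝ)) * Real.exp (C * ∑ i, |y i|) := by
  have h := gaussianShift_mem_Icc v hc y
  rw [← Real.exp_add]
  refine (abs_le.2 ⟨(Real.le_log_iff_exp_le (gaussianShift_pos _ _ _)).2 h.1,
    (Real.log_le_iff_le_exp (gaussianShift_pos _ _ _)).2 h.2⟩).trans
    ((Real.add_one_le_exp _).trans' (by linarith))

lemma measurable_log_gaussianShift (v : ι → ℝ≥0) (c : ι → ℝ) :
    Measurable fun y => Real.log (gaussianShift v c y) :=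
  (measurable_gaussianShift v c).log

/-! ### Matching bounds on the entropy at low signal strength -/

/-- The mean of the log-likelihood of the mean signal. -/
lemma integral_evidence_mul_log_gaussianShift_mean {P : Measure Ω} [IsProbabilityMeasure P]
    {u : Ω → ι → ℝ} (hu : Measurable u) {C : ℝ} (hC : ∀ x i, |u x i| ≤ C) (v : ι → ℝ≥0) :
    ∫ y, evidence P u v y * Real.log (gaussianShift v (fun i => ∫ x, u x i ∂P) y)
      ∂(diagGaussian v) = 1 / 2 * ∑ i, v i * (∫ x, u x i ∂P) ^ 2 := by
  rw [integral_evidence_mul_eq_integral_gaussianShift hu hC v (measurable_log_gaussianShift v _)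
    (abs_log_gaussianShift_le v (abs_mean_le hC))]
  set m : ι → ℝ := fun i => ∫ x, u x i ∂P
  have h1 : ∀ x, ∫ z, Real.log (gaussianShift v m fun i => v i * u x i + z i) ∂(diagGaussian v) =
      ∑ i, (m i * v i * u x i - v i * m i ^ 2 / 2) := by
    intro x
    simp only [gaussianShift, Real.log_exp]
    have hi := integrable_eval_diagGaussian v
    rw [integral_finsetSum _ fun i _ => by
      exact (((integrable_const _).add (hi i)).const_mul _).sub (integrable_const _)]
    refine Finset.sum_congr rfl fun i _ => ?_
    have h2 : Integrable (fun y : ι → ℝ => v i * u x i + y i) (diagGaussian v) :=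
      (integrable_const _).add (hi i)
    rw [integral_sub (h2.const_mul _) (integrable_const _),
      integral_const_mul, integral_add (integrable_const _) (hi i), integral_eval_diagGaussian]
    simp
    ring
  simp_rw [h1]
  have hi := integrable_coord (P := P) hu hC
  rw [integral_finsetSum _ fun i _ => by exact ((hi i).const_mul _).sub (integrable_const _),
    Finset.mul_sum]
  refine Finset.sum_congr rfl fun i _ => ?_
  rw [integral_sub ((hi i).const_mul _) (integrable_const _), integral_const_mul]
  simp [m]
  ring

/-- A Gaussian channel has at least the relative entropy of the shift by the mean signal. -/
lemma half_sum_sq_mean_le_channelEntropy {P : Measure Ω} [IsProbabilityMeasure P]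
    {u : Ω → ι → ℝ} (hu : Measurable u) {C : ℝ} (hC : ∀ x i, |u x i| ≤ C) (v : ι → ℝ≥0) :
    1 / 2 * ∑ i, v i * (∫ x, u x i ∂P) ^ 2 ≤ channelEntropy P u v := by
  rw [← integral_evidence_mul_log_gaussianShift_mean hu hC v, channelEntropy]
  set m : ι → ℝ := fun i => ∫ x, u x i ∂P
  have hi := integrable_evidence_mul (P := P) hu hC v (measurable_log_gaussianShift v m)
    (abs_log_gaussianShift_le v (abs_mean_le hC))
  have hZ := integrable_evidence (P := P) hu hC v
  -- Gibbs' inequality: `log t ≤ t - 1` at `t = gaussianShift / evidence`. The added difference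
  -- integrates to zero, both densities having mass `1`.
  have h : ∫ y, (evidence P u v y * Real.log (gaussianShift v m y) +
      (evidence P u v y - gaussianShift v m y)) ∂(diagGaussian v) ≤
      ∫ y, evidence P u v y * Real.log (evidence P u v y) ∂(diagGaussian v) := by
    refine integral_mono (hi.add (hZ.sub (integrable_gaussianShift v m)))
      (integrable_evidence_mul_log hu hC v v) fun y => ?_
    have hp := evidence_pos (P := P) hu hC v y
    have hg := gaussianShift_pos v m y
    have := Real.log_le_sub_one_of_pos (div_pos hg hp)
    rw [Real.log_div hg.ne' hp.ne'] at this
    have := mul_le_mul_of_nonneg_left this hp.le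
    have e : evidence P u v y * (gaussianShift v m y / evidence P u v y - 1) =
      gaussianShift v m y - evidence P u v y := by field_simp
    simp only
    linarith
  have hd : Integrable (fun y => evidence P u v y - gaussianShift v m y) (diagGaussian v) :=
    hZ.sub (integrable_gaussianShift v m)
  rwa [integral_add hi hd,
    integral_sub hZ (integrable_gaussianShift v m), integral_evidence hu hC,
    integral_gaussianShift, sub_self, add_zero] at h

/-- Completing the square leaves a shift of mass `1` and a factor coupling the centered `a` and `b`.
Integrated over the noise, it turns the second moment of the evidence into a two-replica average. -/
lemma gaussianShift_mul_div (v : ι → ℝ≥0) (a b m y : ι → ℝ) :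
    gaussianShift v a y * gaussianShift v b y / gaussianShift v m y =
      Real.exp (∑ i, v i * ((a i - m i) * (b i - m i))) *
        gaussianShift v (fun i => a i + b i - m i) y := by
  simp only [gaussianShift, ← Real.exp_add, ← Real.exp_sub, ← Finset.sum_add_distrib,
    ← Finset.sum_sub_distrib]
  congr 1
  exact Finset.sum_congr rfl fun i _ => by ring

lemma inv_gaussianShift_le {C : ℝ} (v : ι → ℝ≥0) {c : ι → ℝ} (hc : ∀ i, |c i| ≤ C) (y : ι → ℝ) :
    (gaussianShift v c y)⁻¹ ≤
      Real.exp (C * (∑ i, |y i|) + C ^ 2 * ∑ i, (v i : ℝ)) := by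
  rw [inv_le_comm₀ (gaussianShift_pos _ _ _) (Real.exp_pos _), ← Real.exp_neg]
  exact (gaussianShift_mem_Icc v hc y).1

lemma integrable_evidence_sq_div {P : Measure Ω} [IsProbabilityMeasure P]
    {u : Ω → ι → ℝ} (hu : Measurable u) {C : ℝ} (hC : ∀ x i, |u x i| ≤ C) (v : ι → ℝ≥0)
    {m : ι → ℝ} (hm : ∀ i, |m i| ≤ C) :
    Integrable (fun y => evidence P u v y ^ 2 / gaussianShift v m y) (diagGaussian v) := by
  refine integrable_of_le_exp_sum_abs (A := Real.exp (3 * C ^ 2 * ∑ i, (v i : ℝ))) (c := 3 * C)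
    (((measurable_evidence P v hu).pow_const 2).div (measurable_gaussianShift v m)) fun y => ?_
  have hp := evidence_pos (P := P) hu hC v y
  rw [abs_of_pos (div_pos (by positivity) (gaussianShift_pos _ _ _)), div_eq_mul_inv]
  calc _ ≤ Real.exp (C * (∑ i, |y i|) + C ^ 2 * ∑ i, (v i : ℝ)) ^ 2 * _ :=
        mul_le_mul (pow_le_pow_left₀ hp.le (evidence_mem_Icc hu hC v y).2 2)
          (inv_gaussianShift_le v hm y) (inv_nonneg.2 (gaussianShift_pos _ _ _).le) (by positivity)
    _ = _ := by rw [← Real.exp_nat_mul, ← Real.exp_add, ← Real.exp_add]; congr 1; push_cast; ring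

/-- The second moment of the likelihood ratio relative to a shifted Gaussian. -/
lemma integral_evidence_sq_div {P : Measure Ω} [IsProbabilityMeasure P]
    {u : Ω → ι → ℝ} (hu : Measurable u) {C : ℝ} (hC : ∀ x i, |u x i| ≤ C) (v : ι → ℝ≥0)
    {m : ι → ℝ} (hm : ∀ i, |m i| ≤ C) :
    ∫ y, evidence P u v y ^ 2 / gaussianShift v m y ∂(diagGaussian v) =
      ∫ q : Ω × Ω, Real.exp (∑ i, v i * ((u q.1 i - m i) * (u q.2 i - m i))) ∂(P.prod P) := by
  have h1 : ∀ y, evidence P u v y ^ 2 / gaussianShift v m y = ∫ q : Ω × Ω,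
      gaussianShift v (u q.1) y * gaussianShift v (u q.2) y / gaussianShift v m y
        ∂(P.prod P) := fun y => by
    rw [integral_div, integral_prod_mul (fun x => gaussianShift v (u x) y)
      (fun x => gaussianShift v (u x) y), sq]
    rfl
  simp_rw [h1]
  have hmeas : Measurable fun r : (ι → ℝ) × (Ω × Ω) =>
      gaussianShift v (u r.2.1) r.1 * gaussianShift v (u r.2.2) r.1 / gaussianShift v m r.1 := by
    unfold gaussianShift; fun_prop
  rw [integral_integral_swap]
  · refine integral_congr_ae (ae_of_all _ fun q => ?_)
    simp_rw [gaussianShift_mul_div]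
    rw [integral_const_mul, integral_gaussianShift, mul_one]
  · have hb : Integrable (fun r : (ι → ℝ) × (Ω × Ω) =>
        Real.exp (3 * C ^ 2 * ∑ i, (v i : ℝ)) * Real.exp (3 * C * ∑ i, |r.1 i|) * (1 : ℝ))
        ((diagGaussian v).prod (P.prod P)) :=
      Integrable.mul_prod ((integrable_exp_sum_abs v (3 * C)).const_mul _) (integrable_const _)
    refine hb.mono' hmeas.aestronglyMeasurable (ae_of_all _ fun r => ?_)
    have p1 := gaussianShift_pos v (u r.2.1) r.1
    have p2 := gaussianShift_pos v (u r.2.2) r.1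
    have p3 := gaussianShift_pos v m r.1
    simp only [Function.uncurry_def]
    rw [Real.norm_of_nonneg (by positivity), div_eq_mul_inv]
    calc _ ≤ Real.exp (C * (∑ i, |r.1 i|) + C ^ 2 * ∑ i, (v i : ℝ)) *
          Real.exp (C * (∑ i, |r.1 i|) + C ^ 2 * ∑ i, (v i : ℝ)) *
          Real.exp (C * (∑ i, |r.1 i|) + C ^ 2 * ∑ i, (v i : ℝ)) := by
          gcongr
          · exact (gaussianShift_mem_Icc v (hC _) _).2
          · exact (gaussianShift_mem_Icc v (hC _) _).2
          · exact inv_gaussianShift_le v hm _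
      _ = _ := by rw [mul_one, ← Real.exp_add, ← Real.exp_add, ← Real.exp_add]; ring_nf

lemma abs_sum_centered_le {C : ℝ} {a b m : ι → ℝ} (ha : ∀ i, |a i| ≤ C) (hb : ∀ i, |b i| ≤ C)
    (hm : ∀ i, |m i| ≤ C) (v : ι → ℝ≥0) :
    |∑ i, v i * ((a i - m i) * (b i - m i))| ≤ 4 * C ^ 2 * ∑ i, (v i : ℝ) := by
  refine (Finset.abs_sum_le_sum_abs _ _).trans ?_
  rw [Finset.mul_sum]
  refine Finset.sum_le_sum fun i _ => ?_
  have h1 : |a i - m i| ≤ 2 * C := (abs_sub _ _).trans (by linarith [ha i, hm i])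
  have h2 : |b i - m i| ≤ 2 * C := (abs_sub _ _).trans (by linarith [hb i, hm i])
  rw [abs_mul, abs_mul, NNReal.abs_eq]
  have := mul_le_mul h1 h2 (abs_nonneg _) ((abs_nonneg _).trans h1)
  nlinarith [mul_le_mul_of_nonneg_left this (v i).coe_nonneg]

/-- At low signal strength, the relative entropy of a Gaussian channel is that of the shift by the
mean signal, up to an error of second order. -/
lemma channelEntropy_le {P : Measure Ω} [IsProbabilityMeasure P]
    {u : Ω → ι → ℝ} (hu : Measurable u) {C : ℝ} (hC : ∀ x i, |u x i| ≤ C) (v : ι → ℝ≥0)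
    (hv : 4 * C ^ 2 * ∑ i, (v i : ℝ) ≤ 1) :
    channelEntropy P u v ≤
      1 / 2 * ∑ i, v i * (∫ x, u x i ∂P) ^ 2 + (4 * C ^ 2 * ∑ i, (v i : ℝ)) ^ 2 := by
  rw [← integral_evidence_mul_log_gaussianShift_mean hu hC v, channelEntropy]
  have hmC := abs_mean_le (P := P) hC
  have hcoord := integrable_coord (P := P) hu hC
  set m : ι → ℝ := fun i => ∫ x, u x i ∂P with hm
  set e : ℝ := 4 * C ^ 2 * ∑ i, (v i : ℝ) with he
  have hi := integrable_evidence_mul (P := P) hu hC v (measurable_log_gaussianShift v m)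
    (abs_log_gaussianShift_le v hmC)
  have hZ := integrable_evidence (P := P) hu hC v
  have hZ2 := integrable_evidence_sq_div (P := P) hu hC v hmC
  -- Relative entropy is at most chi-square divergence: `log t ≤ t - 1` now with `t = evidence /
  -- gaussianShift`.
  have h : ∫ y, evidence P u v y * Real.log (evidence P u v y) ∂(diagGaussian v) ≤
      ∫ y, (evidence P u v y * Real.log (gaussianShift v m y) +
      (evidence P u v y ^ 2 / gaussianShift v m y - evidence P u v y)) ∂(diagGaussian v) := by
    refine integral_mono (integrable_evidence_mul_log hu hC v v) (hi.add (hZ2.sub hZ)) fun y => ?_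
    have hp := evidence_pos (P := P) hu hC v y
    have hg := gaussianShift_pos v m y
    have := Real.log_le_sub_one_of_pos (div_pos hp hg)
    rw [Real.log_div hp.ne' hg.ne'] at this
    have := mul_le_mul_of_nonneg_left this hp.le
    have e : evidence P u v y * (evidence P u v y / gaussianShift v m y - 1) =
      evidence P u v y ^ 2 / gaussianShift v m y - evidence P u v y := by ring
    simp only
    linarith
  have hd : Integrable (fun y => evidence P u v y ^ 2 / gaussianShift v m y - evidence P u v y)
      (diagGaussian v) := hZ2.sub hZ
  rw [integral_add hi hd, integral_sub hZ2 hZ, integral_evidence hu hC,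
    integral_evidence_sq_div hu hC v hmC] at h
  have hprod : ∀ i, Integrable (fun q : Ω × Ω => (u q.1 i - m i) * (u q.2 i - m i)) (P.prod P) :=
    fun i => ((hcoord i).sub (integrable_const (m i))).mul_prod
      ((hcoord i).sub (integrable_const (m i)))
  have hzint : Integrable (fun q : Ω × Ω => ∑ i, v i * ((u q.1 i - m i) * (u q.2 i - m i)))
      (P.prod P) := integrable_finsetSum _ fun i _ => (hprod i).const_mul _
  have hz : ∫ q : Ω × Ω, ∑ i, v i * ((u q.1 i - m i) * (u q.2 i - m i)) ∂(P.prod P) = 0 := by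
    rw [integral_finsetSum _ fun i _ => (hprod i).const_mul _]
    refine Finset.sum_eq_zero fun i _ => ?_
    rw [integral_const_mul, integral_prod_mul (fun x => u x i - m i) (fun x => u x i - m i),
      integral_sub (hcoord i) (integrable_const _)]
    simp [hm]
  have hexp : ∫ q : Ω × Ω, Real.exp (∑ i, v i * ((u q.1 i - m i) * (u q.2 i - m i)))
      ∂(P.prod P) ≤ 1 + e ^ 2 := by
    -- Here `|exp t - 1 - t| ≤ t²` for `|t| ≤ 1`. The linear term has mean zero because the replicas
    -- are independent and centered, so only the second order remains.
    have hle : ∀ q : Ω × Ω, Real.exp (∑ i, v i * ((u q.1 i - m i) * (u q.2 i - m i))) ≤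
        (∑ i, v i * ((u q.1 i - m i) * (u q.2 i - m i))) + (1 + e ^ 2) := fun q => by
      have hb := abs_sum_centered_le (hC q.1) (hC q.2) hmC v
      have := (abs_le.1 (Real.abs_exp_sub_one_sub_id_le (hb.trans hv))).2
      have h2 := sq_le_sq' (abs_le.1 hb).1 (abs_le.1 hb).2
      linarith
    calc _ ≤ _ := integral_mono_of_nonneg (ae_of_all _ fun q => (Real.exp_pos _).le)
          (hzint.add (integrable_const (1 + e ^ 2))) (ae_of_all _ hle)
      _ = _ := by rw [integral_add' hzint (integrable_const _), hz]; simp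
  linarith

end

/-! ### Posterior measures and the chain rule -/

/-- The posterior law of `x` given the observation `y`. -/
noncomputable def channelPosterior {ι Ω : Type*} [Fintype ι] [MeasurableSpace Ω] (P : Measure Ω)
    (u : Ω → ι → ℝ) (v : ι → ℝ≥0) (y : ι → ℝ) : Measure Ω :=
  P.tilted fun x => ∑ i, (u x i * y i - v i * u x i ^ 2 / 2)

section
variable {ι Ω : Type*} [Fintype ι] [MeasurableSpace Ω]

lemma isProbabilityMeasure_channelPosterior {P : Measure Ω} [IsProbabilityMeasure P]
    {u : Ω → ι → ℝ} (hu : Measurable u) {C : ℝ} (hC : ∀ x i, |u x i| ≤ C) (v : ι → ℝ≥0)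
    (y : ι → ℝ) : IsProbabilityMeasure (channelPosterior P u v y) :=
  isProbabilityMeasure_tilted (integrable_gaussianShift_prior hu hC v y)

/-- Bayes' rule in two stages: the posterior after `y` serves as the prior for the observation `z`.
-/
lemma evidence_mul_evidence_channelPosterior {P : Measure Ω} [IsProbabilityMeasure P]
    {u : Ω → ι → ℝ} (hu : Measurable u) {C : ℝ} (hC : ∀ x i, |u x i| ≤ C) (v w : ι → ℝ≥0)
    (y z : ι → ℝ) :
    evidence P u v y * evidence (channelPosterior P u v y) u w z = evidence P u (v + w) (y + z) := by
  have h : evidence (channelPosterior P u v y) u w z =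
      ∫ x, gaussianShift v (u x) y * gaussianShift w (u x) z / evidence P u v y ∂P := by
    rw [evidence, channelPosterior, integral_tilted]
    refine integral_congr_ae (ae_of_all _ fun x => ?_)
    change gaussianShift v (u x) y / evidence P u v y * _ = _
    ring
  rw [h, integral_div, mul_div_cancel₀ _ (evidence_pos hu hC v y).ne', evidence]
  simp_rw [gaussianShift_add]

lemma integrable_evidence_mul_channelEntropy_aux {P : Measure Ω} [IsProbabilityMeasure P]
    {u : Ω → ι → ℝ} (hu : Measurable u) {C : ℝ} (hC : ∀ x i, |u x i| ≤ C) (v w : ι → ℝ≥0) :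
    Integrable (fun q : (ι → ℝ) × (ι → ℝ) => evidence P u v q.1 *
      (evidence (channelPosterior P u v q.1) u w q.2 *
        Real.log (evidence (channelPosterior P u v q.1) u w q.2)))
      ((diagGaussian v).prod (diagGaussian w)) := by
  have hb : Integrable (fun q : (ι → ℝ) × (ι → ℝ) =>
      (Real.exp (C ^ 2 * ∑ i, (v i : ℝ)) * Real.exp (C * ∑ i, |q.1 i|)) *
      (Real.exp (2 * C ^ 2 * ∑ i, (w i : ℝ)) * Real.exp (2 * C * ∑ i, |q.2 i|)))
      ((diagGaussian v).prod (diagGaussian w)) :=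
    ((integrable_exp_sum_abs v C).const_mul _).mul_prod
      ((integrable_exp_sum_abs w (2 * C)).const_mul _)
  refine hb.mono' (Measurable.aestronglyMeasurable ?_) (ae_of_all _ fun q => ?_)
  · have h1 := measurable_evidence P v hu
    have h2 := measurable_evidence P (v + w) hu
    -- Joint measurability is not visible when the posterior measure depends on `q.1`; the two-stage
    -- Bayes rule writes this evidence as a quotient of measurable functions.
    have h3 : (fun q : (ι → ℝ) × (ι → ℝ) => evidence (channelPosterior P u v q.1) u w q.2) =
        fun q => evidence P u (v + w) (q.1 + q.2) / evidence P u v q.1 := by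
      ext q
      rw [← evidence_mul_evidence_channelPosterior hu hC,
        mul_div_cancel_left₀ _ (evidence_pos hu hC v _).ne']
    have h4 : Measurable fun q : (ι → ℝ) × (ι → ℝ) =>
        evidence (channelPosterior P u v q.1) u w q.2 := by
      rw [h3]; fun_prop
    fun_prop
  · have := isProbabilityMeasure_channelPosterior (P := P) hu hC v q.1
    rw [Real.norm_eq_abs, abs_mul, abs_of_pos (evidence_pos hu hC v _), ← Real.exp_add,
      add_comm (C ^ 2 * _)]
    exact mul_le_mul (evidence_mem_Icc hu hC v _).2 (abs_evidence_mul_log_le hu hC w _)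
      (abs_nonneg _) (Real.exp_pos _).le

lemma integrable_evidence_mul_channelEntropy {P : Measure Ω} [IsProbabilityMeasure P]
    {u : Ω → ι → ℝ} (hu : Measurable u) {C : ℝ} (hC : ∀ x i, |u x i| ≤ C) (v w : ι → ℝ≥0) :
    Integrable (fun y => evidence P u v y * channelEntropy (channelPosterior P u v y) u w)
      (diagGaussian v) := by
  simpa only [integral_const_mul, channelEntropy] using
    (integrable_evidence_mul_channelEntropy_aux (P := P) hu hC v w).integral_prod_left

/-- The chain rule for the relative entropy of a Gaussian channel. -/
lemma channelEntropy_add {P : Measure Ω} [IsProbabilityMeasure P]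
    {u : Ω → ι → ℝ} (hu : Measurable u) {C : ℝ} (hC : ∀ x i, |u x i| ≤ C) (v w : ι → ℝ≥0) :
    channelEntropy P u (v + w) = channelEntropy P u v +
      ∫ y, evidence P u v y * channelEntropy (channelPosterior P u v y) u w ∂(diagGaussian v) := by
  have hm := measurable_evidence P (v + w) hu
  have hg : Measurable fun q : (ι → ℝ) × (ι → ℝ) => q.1 + q.2 := by fun_prop
  have hI := integrable_evidence_mul_log (P := P) hu hC (v + w) (v + w)
  rw [← map_add_prod_diagGaussian, integrable_map_measure (by fun_prop) hg.aemeasurable, Function.comp_def] at hI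
  rw [channelEntropy, ← map_add_prod_diagGaussian, integral_map hg.aemeasurable (by fun_prop),
    integral_prod _ hI, channelEntropy,
    ← integral_add (integrable_evidence_mul_log hu hC v v)
      (integrable_evidence_mul_channelEntropy hu hC v w)]
  refine integral_congr_ae (ae_of_all _ fun y => ?_)
  have := isProbabilityMeasure_channelPosterior (P := P) hu hC v y
  have hy := evidence_pos (P := P) hu hC v y
  have h1 : ∀ z, evidence P u (v + w) (y + z) * Real.log (evidence P u (v + w) (y + z)) =
      evidence P u v y * Real.log (evidence P u v y) * evidence (channelPosterior P u v y) u w z +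
      evidence P u v y * (evidence (channelPosterior P u v y) u w z *
        Real.log (evidence (channelPosterior P u v y) u w z)) := fun z => by
    rw [← evidence_mul_evidence_channelPosterior hu hC,
      Real.log_mul hy.ne' (evidence_pos hu hC w z).ne']
    ring
  simp only [h1]
  rw [integral_add ((integrable_evidence hu hC w).const_mul _)
    ((integrable_evidence_mul_log hu hC w w).const_mul _), integral_const_mul, integral_const_mul,
    integral_evidence hu hC, mul_one]
  rfl

lemma channelEntropy_nonneg {P : Measure Ω} [IsProbabilityMeasure P]
    {u : Ω → ι → ℝ} (hu : Measurable u) {C : ℝ} (hC : ∀ x i, |u x i| ≤ C) (v : ι → ℝ≥0) :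
    0 ≤ channelEntropy P u v :=
  (half_sum_sq_mean_le_channelEntropy hu hC v).trans' (by positivity)

/-- By the chain rule the increase is an average of nonnegative posterior entropies. -/
lemma channelEntropy_le_add {P : Measure Ω} [IsProbabilityMeasure P]
    {u : Ω → ι → ℝ} (hu : Measurable u) {C : ℝ} (hC : ∀ x i, |u x i| ≤ C) (v w : ι → ℝ≥0) :
    channelEntropy P u v ≤ channelEntropy P u (v + w) := by
  rw [channelEntropy_add hu hC v w, le_add_iff_nonneg_right]
  refine integral_nonneg fun y => mul_nonneg (evidence_pos hu hC v y).le ?_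
  have := isProbabilityMeasure_channelPosterior (P := P) hu hC v y
  exact channelEntropy_nonneg hu hC w

/-! ### Interpolation between two channels -/

/-- A squared mean is the mean of a product over two independent replicas, so a bound for all pairs
`x, x'` passes to the means, whatever the signs of `a`. -/
lemma sum_mul_sq_mean_ge {P : Measure Ω} [IsProbabilityMeasure P]
    {u : Ω → ι → ℝ} (hu : Measurable u) {C : ℝ} (hC : ∀ x i, |u x i| ≤ C) (a : ι → ℝ) {c : ℝ}
    (hc : ∀ x x', -c ≤ ∑ i, a i * (u x i * u x' i)) :
    -c ≤ ∑ i, a i * (∫ x, u x i ∂P) ^ 2 := by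
  have hi := integrable_coord (P := P) hu hC
  have h : ∑ i, a i * (∫ x, u x i ∂P) ^ 2 =
      ∫ q : Ω × Ω, ∑ i, a i * (u q.1 i * u q.2 i) ∂(P.prod P) := by
    rw [integral_finsetSum _ fun i _ => ((hi i).mul_prod (hi i)).const_mul _]
    refine Finset.sum_congr rfl fun i _ => ?_
    rw [integral_const_mul, integral_prod_mul (fun x => u x i) (fun x => u x i), sq]
  rw [h]
  simpa using integral_mono (μ := P.prod P) (integrable_const (-c))
    (integrable_finsetSum _ fun i _ => ((hi i).mul_prod (hi i)).const_mul (a i))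
    fun q => hc q.1 q.2

/-- One step of the interpolation between two Gaussian channels. -/
lemma channelEntropy_add_le_add {P : Measure Ω} [IsProbabilityMeasure P]
    {u : Ω → ι → ℝ} (hu : Measurable u) {C : ℝ} (hC : ∀ x i, |u x i| ≤ C) (v w₀ w₁ : ι → ℝ≥0)
    (hw : 4 * C ^ 2 * ∑ i, (w₀ i : ℝ) ≤ 1) {c : ℝ}
    (hc : ∀ x x', -c ≤ ∑ i, ((w₁ i : ℝ) - w₀ i) * (u x i * u x' i)) :
    channelEntropy P u (v + w₀) ≤
      channelEntropy P u (v + w₁) + (c / 2 + (4 * C ^ 2 * ∑ i, (w₀ i : ℝ)) ^ 2) := by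
  rw [channelEntropy_add hu hC, channelEntropy_add hu hC, add_assoc, add_le_add_iff_left]
  set E := c / 2 + (4 * C ^ 2 * ∑ i, (w₀ i : ℝ)) ^ 2
  have h1 := integrable_evidence_mul_channelEntropy (P := P) hu hC v w₁
  have h2 := (integrable_evidence (P := P) hu hC v).mul_const E
  have h : ∫ y, evidence P u v y * channelEntropy (channelPosterior P u v y) u w₀
      ∂(diagGaussian v) ≤ ∫ y, (evidence P u v y * channelEntropy (channelPosterior P u v y) u w₁ +
        evidence P u v y * E) ∂(diagGaussian v) := by
    refine integral_mono (integrable_evidence_mul_channelEntropy hu hC v w₀) (h1.add h2)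
      fun y => ?_
    have := isProbabilityMeasure_channelPosterior (P := P) hu hC v y
    simp only
    rw [← mul_add]
    refine mul_le_mul_of_nonneg_left ?_ (evidence_pos hu hC v y).le
    -- Under the same posterior, the `w₀` step is bounded above and the `w₁` step below; the leading
    -- terms differ by a quadratic form in the means, controlled by the kernel.
    have l1 := channelEntropy_le (P := channelPosterior P u v y) hu hC w₀ hw
    have l2 := half_sum_sq_mean_le_channelEntropy (P := channelPosterior P u v y) hu hC w₁
    have l3 := sum_mul_sq_mean_ge (P := channelPosterior P u v y) hu hC _ hc
    simp only [sub_mul, Finset.sum_sub_distrib] at l3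
    simp only [E]
    linarith
  rwa [integral_add h1 h2, integral_mul_const, integral_evidence hu hC, one_mul] at h

/-- **Comparison of Gaussian channels**: a pointwise bound on the difference of the covariance
kernels bounds the difference of the relative entropies. -/
theorem channelEntropy_le_of_kernel_le {P : Measure Ω} [IsProbabilityMeasure P]
    {u : Ω → ι → ℝ} (hu : Measurable u) {C : ℝ} (hC : ∀ x i, |u x i| ≤ C) (v₀ v₁ : ι → ℝ≥0) {c : ℝ}
    (hc : ∀ x x', -c ≤ ∑ i, ((v₁ i : ℝ) - v₀ i) * (u x i * u x' i)) :
    channelEntropy P u v₀ ≤ channelEntropy P u v₁ + c / 2 := by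
  set V := 4 * C ^ 2 * ∑ i, (v₀ i : ℝ) with hV
  have hV0 : 0 ≤ V := by positivity
  -- With `m` steps each costs `(V / m) ^ 2`, in total `V ^ 2 / m`. The condition `V ≤ m` puts each
  -- step in the low-strength regime.
  have key : ∀ m : ℕ, 0 < m → V ≤ m →
      channelEntropy P u v₀ ≤ channelEntropy P u v₁ + c / 2 + V ^ 2 * (m : ℝ)⁻¹ := by
    intro m hm hVm
    have hm' : (0 : ℝ) < m := by exact_mod_cast hm
    set w₀ : ι → ℝ≥0 := fun i => v₀ i / m with hw₀
    set w₁ : ι → ℝ≥0 := fun i => v₁ i / m with hw₁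
    have hsum : 4 * C ^ 2 * ∑ i, (w₀ i : ℝ) = V / m := by
      simp [hw₀, hV, ← Finset.sum_div, mul_div_assoc]
    have hstep : ∀ v, channelEntropy P u (v + w₀) ≤
        channelEntropy P u (v + w₁) + (c / m / 2 + (V / m) ^ 2) := by
      intro v
      rw [← hsum]
      refine channelEntropy_add_le_add hu hC v w₀ w₁ ?_ fun x x' => ?_
      · rw [hsum]; exact (div_le_one hm').2 hVm
      · have : ∑ i, ((w₁ i : ℝ) - w₀ i) * (u x i * u x' i) =
            (∑ i, ((v₁ i : ℝ) - v₀ i) * (u x i * u x' i)) / m := by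
          rw [Finset.sum_div]
          refine Finset.sum_congr rfl fun i _ => ?_
          simp [hw₀, hw₁]
          ring
        rw [this, ← neg_div]
        exact div_le_div_of_nonneg_right (hc x x') hm'.le
    -- `k` increments have been exchanged and `j` are pending; `j` stays general because each
    -- exchange consumes a pending one.
    have hiter : ∀ k j : ℕ, channelEntropy P u ((k + j : ℕ) • w₀) ≤
        channelEntropy P u (k • w₁ + j • w₀) + k * (c / m / 2 + (V / m) ^ 2) := by
      intro k
      induction k with
      | zero => intro j; simp
      | succ k ih =>
        intro j
        have h1 := ih (j + 1)
        have h2 := hstep (k • w₁ + j • w₀)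
        rw [show k + 1 + j = k + (j + 1) by ring]
        rw [show k • w₁ + j • w₀ + w₀ = k • w₁ + (j + 1) • w₀ by rw [succ_nsmul]; abel,
          show k • w₁ + j • w₀ + w₁ = (k + 1) • w₁ + j • w₀ by rw [succ_nsmul]; abel] at h2
        push_cast
        linarith
    have h := hiter m 0
    have e : ∀ v : ι → ℝ≥0, (m • fun i => v i / (m : ℝ≥0)) = v := fun v => by
      ext i
      simp
      field_simp
    simp only [add_zero, zero_nsmul, hw₀, hw₁, e] at h
    refine h.trans (le_of_eq ?_)
    field_simp
    ring
  have hlim : Tendsto (fun m : ℕ => channelEntropy P u v₁ + c / 2 + V ^ 2 * (m : ℝ)⁻¹) atTop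
      (nhds (channelEntropy P u v₁ + c / 2)) := by
    simpa using (tendsto_const_nhds (x := channelEntropy P u v₁ + c / 2)).add
      ((tendsto_inv_atTop_nhds_zero_nat (𝕜 := ℝ)).const_mul (V ^ 2))
  refine ge_of_tendsto hlim ?_
  obtain ⟨N, hN⟩ := exists_nat_ge V
  filter_upwards [eventually_ge_atTop N, eventually_gt_atTop 0] with m h1 h2
  exact key m h2 (hN.trans (by exact_mod_cast h1))

end

/-! ### Unit noise and square-integrable signals -/

/-- The mean log-evidence of the observation `u(X) + Z` of the signal `u(X)` in standard noise. -/
noncomputable def meanLogEvidence {ι Ω : Type*} [Fintype ι] [MeasurableSpace Ω] (P : Measure Ω)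
    (u : Ω → ι → ℝ) : ℝ :=
  ∫ ω, Real.log (evidence P u 1 (u ω.1 + ω.2)) ∂(P.prod (diagGaussian 1))

section
variable {ι κ Ω : Type*} [Fintype ι] [Fintype κ] [MeasurableSpace Ω]

/-- Completing the square gives a bound free of the signal, so the evidence is finite without any
moment. -/
lemma gaussianShift_one_le (c y : ι → ℝ) :
    gaussianShift 1 c y ≤ Real.exp (∑ i, y i ^ 2 / 2) := by
  unfold gaussianShift
  refine Real.exp_le_exp.2 (Finset.sum_le_sum fun i _ => ?_)
  simp only [Pi.one_apply, NNReal.coe_one]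
  nlinarith [sq_nonneg (c i - y i)]

lemma integrable_gaussianShift_one {P : Measure Ω} [IsFiniteMeasure P] {u : Ω → ι → ℝ}
    (hu : Measurable u) (y : ι → ℝ) : Integrable (fun x => gaussianShift 1 (u x) y) P := by
  refine Integrable.of_bound (by unfold gaussianShift; fun_prop)
    (Real.exp (∑ i, y i ^ 2 / 2)) (ae_of_all _ fun x => ?_)
  rw [Real.norm_of_nonneg (gaussianShift_pos _ _ _).le]
  exact gaussianShift_one_le _ _

lemma evidence_one_pos {P : Measure Ω} [IsProbabilityMeasure P] {u : Ω → ι → ℝ}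
    (hu : Measurable u) (y : ι → ℝ) : 0 < evidence P u 1 y :=
  integral_exp_pos (integrable_gaussianShift_one hu y)

lemma log_evidence_one_le {P : Measure Ω} [IsProbabilityMeasure P] {u : Ω → ι → ℝ}
    (hu : Measurable u) (y : ι → ℝ) : Real.log (evidence P u 1 y) ≤ ∑ i, y i ^ 2 / 2 := by
  rw [Real.log_le_iff_le_exp (evidence_one_pos hu y)]
  simpa [evidence] using integral_mono (integrable_gaussianShift_one (P := P) hu y)
    (integrable_const _) fun x => gaussianShift_one_le (u x) y

lemma exp_integral_le {P : Measure Ω} [IsProbabilityMeasure P] {f : Ω → ℝ}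
    (hf : Integrable f P) (he : Integrable (fun x => Real.exp (f x)) P) :
    Real.exp (∫ x, f x ∂P) ≤ ∫ x, Real.exp (f x) ∂P := by
  exact convexOn_exp.map_integral_le Real.continuous_exp.continuousOn isClosed_univ
    (ae_of_all _ fun _ => Set.mem_univ _) hf he

/-- The lower bound is Jensen's inequality. Stating it through a dominating `g` makes it uniform
over the truncations of `g`. -/
lemma abs_log_evidence_one_le {P : Measure Ω} [IsProbabilityMeasure P] {u g : Ω → ι → ℝ}
    (hu : Measurable u) (hg : ∀ i, Integrable (fun x => g x i ^ 2) P)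
    (hug : ∀ x i, |u x i| ≤ |g x i|) (y : ι → ℝ) :
    |Real.log (evidence P u 1 y)| ≤ ∑ i, (y i ^ 2 / 2 + ∫ x, g x i ^ 2 ∂P) := by
  have hint : Integrable (fun x => -∑ i, (y i ^ 2 / 2 + g x i ^ 2)) P :=
    (integrable_finsetSum _ fun i _ => (integrable_const _).add (hg i)).neg
  have hle : ∀ x, -∑ i, (y i ^ 2 / 2 + g x i ^ 2) ≤
      ∑ i, (u x i * y i - (1 : ι → ℝ≥0) i * u x i ^ 2 / 2) := fun x => by
    rw [← Finset.sum_neg_distrib]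
    refine Finset.sum_le_sum fun i _ => ?_
    have := sq_le_sq.2 (hug x i)
    simp only [Pi.one_apply, NNReal.coe_one]
    nlinarith [sq_nonneg (u x i + y i)]
  have hexp : Integrable (fun x => Real.exp (-∑ i, (y i ^ 2 / 2 + g x i ^ 2))) P :=
    (integrable_gaussianShift_one (P := P) hu y).mono'
      (Real.continuous_exp.comp_aestronglyMeasurable hint.1)
      (ae_of_all _ fun x => by
        rw [Real.norm_of_nonneg (Real.exp_pos _).le]; exact Real.exp_le_exp.2 (hle x))
  refine abs_le.2 ⟨?_, (log_evidence_one_le hu y).trans (Finset.sum_le_sum fun i _ => ?_)⟩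
  · rw [Real.le_log_iff_exp_le (evidence_one_pos hu y)]
    have h1 : ∫ x, -∑ i, (y i ^ 2 / 2 + g x i ^ 2) ∂P =
        -∑ i, (y i ^ 2 / 2 + ∫ x, g x i ^ 2 ∂P) := by
      rw [integral_neg, integral_finsetSum _ fun i _ => by exact (integrable_const _).add (hg i)]
      congr 1
      refine Finset.sum_congr rfl fun i _ => ?_
      rw [integral_add (integrable_const _) (hg i)]
      simp
    rw [← h1]
    exact (exp_integral_le hint hexp).trans (integral_mono hexp (integrable_gaussianShift_one hu y)
      fun x => Real.exp_le_exp.2 (hle x))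
  · exact le_add_of_nonneg_right (integral_nonneg fun x => sq_nonneg _)

lemma measurable_log_evidence_add (P : Measure Ω) [SFinite P] {u : Ω → ι → ℝ} (hu : Measurable u) :
    Measurable fun ω : Ω × (ι → ℝ) => Real.log (evidence P u 1 (u ω.1 + ω.2)) := by
  have := measurable_evidence P 1 hu
  fun_prop

lemma integrable_logEvidenceBound {P : Measure Ω} [IsProbabilityMeasure P] {g : Ω → ι → ℝ}
    (hg : ∀ i, Integrable (fun x => g x i ^ 2) P) :
    Integrable (fun ω : Ω × (ι → ℝ) =>
      ∑ i, (g ω.1 i ^ 2 + ω.2 i ^ 2 + ∫ x, g x i ^ 2 ∂P)) (P.prod (diagGaussian 1)) :=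
  integrable_finsetSum _ fun i _ => (((hg i).comp_fst _).add
    ((integrable_sq_eval_diagGaussian 1 i).comp_snd _)).add (integrable_const _)

lemma abs_log_evidence_add_le {P : Measure Ω} [IsProbabilityMeasure P] {u g : Ω → ι → ℝ}
    (hu : Measurable u) (hg : ∀ i, Integrable (fun x => g x i ^ 2) P)
    (hug : ∀ x i, |u x i| ≤ |g x i|) (ω : Ω × (ι → ℝ)) :
    |Real.log (evidence P u 1 (u ω.1 + ω.2))| ≤
      ∑ i, (g ω.1 i ^ 2 + ω.2 i ^ 2 + ∫ x, g x i ^ 2 ∂P) := by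
  refine (abs_log_evidence_one_le hu hg hug _).trans (Finset.sum_le_sum fun i _ => ?_)
  have := sq_le_sq.2 (hug ω.1 i)
  simp only [Pi.add_apply]
  nlinarith [sq_nonneg (u ω.1 i - ω.2 i)]

lemma integrable_log_evidence {P : Measure Ω} [IsProbabilityMeasure P] {u : Ω → ι → ℝ}
    (hu : Measurable u) (hu2 : ∀ i, Integrable (fun x => u x i ^ 2) P) :
    Integrable (fun ω : Ω × (ι → ℝ) => Real.log (evidence P u 1 (u ω.1 + ω.2)))
      (P.prod (diagGaussian 1)) :=
  (integrable_logEvidenceBound hu2).mono' (measurable_log_evidence_add P hu).aestronglyMeasurable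
    (ae_of_all _ fun ω => abs_log_evidence_add_le hu hu2 (fun _ _ => le_rfl) ω)

/-- The mean log-evidence is continuous along dominated pointwise limits of the signal. -/
lemma tendsto_meanLogEvidence {P : Measure Ω} [IsProbabilityMeasure P] {u : ℕ → Ω → ι → ℝ}
    {g : Ω → ι → ℝ} (hu : ∀ N, Measurable (u N)) (hgm : Measurable g)
    (hg : ∀ i, Integrable (fun x => g x i ^ 2) P) (hug : ∀ N x i, |u N x i| ≤ |g x i|)
    (hlim : ∀ x i, Tendsto (fun N => u N x i) atTop (nhds (g x i))) :
    Tendsto (fun N => meanLogEvidence P (u N)) atTop (nhds (meanLogEvidence P g)) := by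
  refine tendsto_integral_of_dominated_convergence _
    (fun N => (measurable_log_evidence_add P (hu N)).aestronglyMeasurable)
    (integrable_logEvidenceBound hg)
    (fun N => ae_of_all _ fun ω => abs_log_evidence_add_le (hu N) hg (hug N) ω)
    (ae_of_all _ fun ω => ?_)
  refine Tendsto.log ?_ (evidence_one_pos hgm _).ne'
  refine tendsto_integral_of_dominated_convergence
    (fun _ => Real.exp (∑ i, (|g ω.1 i| + |ω.2 i|) ^ 2 / 2))
    (fun N => (integrable_gaussianShift_one (hu N) _).1) (integrable_const _)
    (fun N => ae_of_all _ fun x => ?_) (ae_of_all _ fun x => ?_)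
  · rw [Real.norm_of_nonneg (gaussianShift_pos _ _ _).le]
    refine (gaussianShift_one_le _ _).trans (Real.exp_le_exp.2 (Finset.sum_le_sum fun i _ => ?_))
    refine div_le_div_of_nonneg_right (sq_le_sq.2 ?_) (by norm_num)
    rw [abs_of_nonneg (a := |g ω.1 i| + |ω.2 i|) (by positivity)]
    exact (abs_add_le _ _).trans (add_le_add (hug N _ _) le_rfl)
  · refine (Real.continuous_exp.tendsto _).comp (tendsto_finsetSum _ fun i _ => ?_)
    simp only [Pi.add_apply]
    exact ((hlim x i).mul ((hlim ω.1 i).add tendsto_const_nhds)).sub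
      ((((hlim x i).pow 2).const_mul _).div_const _)

lemma channelEntropy_one_eq_meanLogEvidence {P : Measure Ω} [IsProbabilityMeasure P]
    {u : Ω → ι → ℝ} (hu : Measurable u) {C : ℝ} (hC : ∀ x i, |u x i| ≤ C) :
    channelEntropy P u 1 = meanLogEvidence P u := by
  have h2 : ∀ i, Integrable (fun x => u x i ^ 2) P := fun i =>
    Integrable.of_bound (by fun_prop) (C ^ 2) (ae_of_all _ fun x => by
      rw [Real.norm_of_nonneg (sq_nonneg _)]
      exact sq_le_sq' (abs_le.1 (hC x i)).1 (abs_le.1 (hC x i)).2)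
  rw [channelEntropy, meanLogEvidence, integral_prod _ (integrable_log_evidence hu h2),
    integral_evidence_mul_eq_integral_gaussianShift hu hC 1 (measurable_evidence P 1 hu).log
      (A := Real.exp (C ^ 2 * ∑ i, ((1 : ι → ℝ≥0) i : ℝ))) (c := C) fun y => ?_]
  · simp only [Pi.one_apply, NNReal.coe_one, one_mul]
    rfl
  · refine (abs_log_evidence_le hu hC 1 y).trans ?_
    rw [← Real.exp_add]
    exact (Real.add_one_le_exp _).trans' (by linarith)

lemma measurable_extend_zero {ι κ : Type*} {e : κ → ι} (he : Function.Injective e) :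
    Measurable fun y : κ → ℝ => Function.extend e y (0 : ι → ℝ) := by
  refine measurable_pi_iff.2 fun i => ?_
  by_cases hi : ∃ k, e k = i
  · obtain ⟨k, rfl⟩ := hi
    simpa only [he.extend_apply] using measurable_pi_apply k
  · simp only [Function.extend_apply' _ _ _ hi]
    exact measurable_const

/-- A coordinate of variance zero is almost surely `0`, hence extension by zero loses nothing. -/
lemma map_extend_diagGaussian {e : κ → ι} (he : Function.Injective e) {v : ι → ℝ≥0}
    (hv : ∀ i, i ∉ Set.range e → v i = 0) :
    (diagGaussian (v ∘ e)).map (fun y => Function.extend e y (0 : ι → ℝ)) = diagGaussian v := by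
  classical
  have hm := measurable_extend_zero he
  refine (Measure.pi_eq (μ := fun i => gaussianReal 0 (v i)) fun s hs => ?_).symm
  rw [Measure.map_apply hm (MeasurableSet.univ_pi hs)]
  by_cases h0 : ∀ i, i ∉ Set.range e → (0 : ℝ) ∈ s i
  · have hpre : (fun y : κ → ℝ => Function.extend e y (0 : ι → ℝ)) ⁻¹' Set.univ.pi s =
        Set.univ.pi fun k => s (e k) := by
      ext y
      simp only [Set.mem_preimage, Set.mem_pi, Set.mem_univ, forall_const]
      refine ⟨fun h k => by simpa only [he.extend_apply] using h (e k), fun h i => ?_⟩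
      by_cases hi : ∃ k, e k = i
      · obtain ⟨k, rfl⟩ := hi
        simpa only [he.extend_apply] using h k
      · simpa only [Function.extend_apply' _ _ _ hi, Pi.zero_apply] using h0 i hi
    rw [hpre, diagGaussian, Measure.pi_pi]
    simp only [Function.comp_apply]
    rw [← Finset.prod_image (f := fun i => gaussianReal 0 (v i) (s i)) (g := e)
      fun a _ b _ h => he h]
    refine Finset.prod_subset (Finset.subset_univ _) fun i _ hi => ?_
    have hi' : i ∉ Set.range e := by simpa using hi
    rw [hv i hi', gaussianReal_zero_var, Measure.dirac_apply' _ (hs i),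
      Set.indicator_of_mem (h0 i hi')]
    rfl
  · push Not at h0
    obtain ⟨i, hi, h0⟩ := h0
    have hpre : (fun y : κ → ℝ => Function.extend e y (0 : ι → ℝ)) ⁻¹' Set.univ.pi s = ∅ := by
      refine Set.eq_empty_of_forall_notMem fun y hy => h0 ?_
      simpa only [Function.extend_apply' _ _ _ hi, Pi.zero_apply] using hy i trivial
    rw [hpre, measure_empty]
    refine (Finset.prod_eq_zero (Finset.mem_univ i) ?_).symm
    rw [hv i hi, gaussianReal_zero_var, Measure.dirac_apply' _ (hs i),
      Set.indicator_of_notMem h0]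

/-- The observations of signal strength zero can be discarded. -/
lemma channelEntropy_comp {P : Measure Ω} [IsProbabilityMeasure P] {u : Ω → ι → ℝ}
    (hu : Measurable u) {e : κ → ι} (he : Function.Injective e) {v : ι → ℝ≥0}
    (hv : ∀ i, i ∉ Set.range e → v i = 0) :
    channelEntropy P (fun x k => u x (e k)) (v ∘ e) = channelEntropy P u v := by
  classical
  have hm := measurable_extend_zero he
  have hev := measurable_evidence P v hu
  have h : ∀ y : κ → ℝ, evidence P u v (Function.extend e y (0 : ι → ℝ)) =
      evidence P (fun x k => u x (e k)) (v ∘ e) y := by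
    intro y
    unfold evidence gaussianShift
    refine integral_congr_ae (ae_of_all _ fun x => congrArg Real.exp ?_)
    have := Finset.sum_image (f := fun i => u x i * Function.extend e y (0 : ι → ℝ) i - v i * u x i ^ 2 / 2)
      (s := Finset.univ) (g := e) fun a _ b _ h => he h
    simp only [he.extend_apply] at this
    simp only [Function.comp_apply]
    rw [← this]
    refine (Finset.sum_subset (Finset.subset_univ _) fun i _ hi => ?_).symm
    have hi' : i ∉ Set.range e := by simpa using hi
    rw [hv i hi', Function.extend_apply' _ _ _ hi']
    simp
  rw [channelEntropy, channelEntropy, ← map_extend_diagGaussian he hv,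
    integral_map hm.aemeasurable (by fun_prop)]
  simp_rw [h]

/-- Comparison of the mean log-evidences of two bounded signals. -/
theorem meanLogEvidence_le_of_kernel_le {P : Measure Ω} [IsProbabilityMeasure P]
    {b : Ω → κ → ℝ} {u : Ω → ι → ℝ} (hb : Measurable b) (hu : Measurable u) {C : ℝ}
    (hbC : ∀ x i, |b x i| ≤ C) (huC : ∀ x i, |u x i| ≤ C) {v : ι → ℝ≥0} (hv : v ≤ 1) {c : ℝ}
    (hc : ∀ x x', ∑ j, b x j * b x' j ≤ ∑ i, v i * (u x i * u x' i) + c) :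
    meanLogEvidence P b ≤ meanLogEvidence P u + c / 2 := by
  -- Stacked, the two signals form one channel; the comparison moves the strength from `1` on the
  -- block of `b` to `v` on the block of `u`.
  have hw : Measurable fun x => Sum.elim (u x) (b x) := by
    refine measurable_pi_iff.2 fun i => ?_
    cases i <;> simp only [Sum.elim_inl, Sum.elim_inr] <;> fun_prop
  have hwC : ∀ x (i : ι ⊕ κ), |Sum.elim (u x) (b x) i| ≤ C := fun x i => by
    cases i
    · exact huC x _
    · exact hbC x _
  have h := channelEntropy_le_of_kernel_le (P := P) hw hwC (Sum.elim 0 1) (Sum.elim v 0) (c := c)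
    fun x x' => by
      simp only [Fintype.sum_sum_type, Sum.elim_inl, Sum.elim_inr, Pi.zero_apply, Pi.one_apply,
        NNReal.coe_zero, NNReal.coe_one, sub_zero, zero_sub, neg_one_mul, Finset.sum_neg_distrib]
      linarith [hc x x']
  rw [← channelEntropy_comp hw (e := Sum.inr) Sum.inr_injective (by rintro (i | i) hi <;> simp_all),
    ← channelEntropy_comp hw (e := Sum.inl) Sum.inl_injective
      (by rintro (i | i) hi <;> simp_all)] at h
  simp only [Sum.elim_inl, Sum.elim_inr, Sum.elim_comp_inr, Sum.elim_comp_inl] at h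
  -- Raising the strengths from `v` to `1` can only increase the entropy.
  have h2 := channelEntropy_le_add (P := P) hu huC v (1 - v)
  rw [add_tsub_cancel_of_le hv] at h2
  rw [← channelEntropy_one_eq_meanLogEvidence hb hbC, ← channelEntropy_one_eq_meanLogEvidence hu huC]
  linarith

end

/-! ### Sorted multi-indices and the convexity inequality -/

section Kernel

/-- The sorted rearrangement of a tuple of indices. -/
def sortIndex {n p : ℕ} (f : Fin p → Fin n) : TensorIndex n p :=
  ⟨f ∘ Tuple.sort f, Tuple.monotone_sort f⟩

/-- The fraction of the `p!` rearrangements of a tuple of indices that are distinct. -/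
noncomputable def indexWeight {n p : ℕ} (i : TensorIndex n p) : ℝ≥0 :=
  (Finset.univ.filter fun f : Fin p → Fin n => sortIndex f = i).card / (p ! : ℝ≥0)

/-- Every tuple that sorts to `i` is one of the at most `p!` rearrangements of `i`. -/
lemma indexWeight_le_one {n p : ℕ} (i : TensorIndex n p) : indexWeight i ≤ 1 := by
  classical
  refine div_le_one_of_le₀ ?_ zero_le
  have h : (Finset.univ.filter fun f : Fin p → Fin n => sortIndex f = i) ⊆
      Finset.univ.image fun σ : Equiv.Perm (Fin p) => i.1 ∘ σ := by
    intro f hf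
    rw [Finset.mem_filter] at hf
    refine Finset.mem_image.2 ⟨(Tuple.sort f).symm, Finset.mem_univ _, ?_⟩
    rw [← hf.2]
    ext a
    simp [sortIndex]
  have := (Finset.card_le_card h).trans Finset.card_image_le
  rw [Finset.card_univ, Fintype.card_perm, Fintype.card_fin] at this
  exact_mod_cast this

lemma sum_indexWeight_mul {n p : ℕ} (g : (Fin p → Fin n) → ℝ)
    (hg : ∀ f (σ : Equiv.Perm (Fin p)), g (f ∘ σ) = g f) :
    ∑ i : TensorIndex n p, indexWeight i * g i.1 = (∑ f, g f) / p ! := by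
  classical
  rw [← Finset.sum_fiberwise Finset.univ (sortIndex (n := n) (p := p)) g, Finset.sum_div]
  refine Finset.sum_congr rfl fun i _ => ?_
  have : ∀ f ∈ Finset.univ.filter (fun f : Fin p → Fin n => sortIndex f = i), g f = g i.1 := by
    intro f hf
    rw [Finset.mem_filter] at hf
    rw [← hf.2]
    exact (hg f _).symm
  rw [Finset.sum_congr rfl this, Finset.sum_const, nsmul_eq_mul, indexWeight]
  push_cast
  ring

/-- The weights turn the sum over sorted tuples into one over all tuples, which is the expansion of
a `p`-th power. Tuples with repeated indices are thus counted exactly. -/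
lemma sum_indexWeight_tensorEntry {n p K : ℕ} (x x' : Fin n → Fin K → ℝ) :
    ∑ i : TensorIndex n p, indexWeight i * (tensorEntry x i * tensorEntry x' i) =
      (∑ k, ∑ k', (∑ j, x j k * x' j k') ^ p) / p ! := by
  have h := sum_indexWeight_mul (n := n) (p := p)
    (fun f => (∑ k, ∏ a, x (f a) k) * ∑ k, ∏ a, x' (f a) k) fun f σ => by
      congr 1 <;> refine Finset.sum_congr rfl fun k _ => ?_
      · exact Equiv.prod_comp σ fun a => x (f a) k
      · exact Equiv.prod_comp σ fun a => x' (f a) k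
  unfold tensorEntry
  rw [h]
  congr 1
  simp_rw [Finset.sum_mul_sum, Fintype.sum_pow, ← Finset.prod_mul_distrib]
  rw [Finset.sum_comm]
  exact Finset.sum_congr rfl fun k _ => Finset.sum_comm

/-- The even power `x ↦ x ^ p` is convex and lies above its tangent at `s`. After scaling by `s`
this is Bernoulli's inequality; where `x / s < -1` its left side is negative. -/
lemma pow_tangent_le {p : ℕ} (hp : Even p) (hp0 : 0 < p) (x s : ℝ) :
    p * s ^ (p - 1) * x ≤ x ^ p + (p - 1) * s ^ p := by
  have hp1 : (1 : ℝ) ≤ p := by exact_mod_cast hp0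
  by_cases hs : s = 0
  · subst hs
    obtain ⟨k, rfl⟩ := hp
    rw [zero_pow (by omega), zero_pow (by omega)]
    have : 0 ≤ x ^ (k + k) := Even.pow_nonneg ⟨k, rfl⟩ x
    simpa
  · have hb : 1 + (p : ℝ) * (x / s - 1) ≤ (x / s) ^ p := by
      by_cases h : -2 ≤ x / s - 1
      · simpa using one_add_mul_le_pow h p
      · push Not at h
        have := hp.pow_nonneg (x / s)
        nlinarith
    have hsp := hp.pow_pos hs
    have := mul_le_mul_of_nonneg_right hb hsp.le
    rw [div_pow, div_mul_cancel₀ _ hsp.ne'] at this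
    have e : s ^ p = s ^ (p - 1) * s := (pow_sub_one_mul hp0.ne' s).symm
    have e2 : p * (x / s) * s ^ p = p * s ^ (p - 1) * x := by
      rw [e]; field_simp
    linarith

end Kernel

/-! ### The model as a Gaussian channel -/

section Identification
variable {n p K : ℕ}

lemma signalScale_sq (n p : ℕ) : signalScale n p ^ 2 = ((p - 1)! : ℝ) / (n : ℝ) ^ (p - 1) :=
  Real.sq_sqrt (by positivity)

/-- The scaled tensor with entries indexed by nondecreasing tuples. -/
noncomputable def tensorSignal (n p K : ℕ) (x : Fin n → Fin K → ℝ) (i : TensorIndex n p) : ℝ :=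
  signalScale n p * tensorEntry x i

lemma continuous_tensorSignal : Continuous (tensorSignal n p K) := by
  unfold tensorSignal tensorEntry; fun_prop

lemma exp_neg_hamiltonian (x : Fin n → Fin K → ℝ) (Y : TensorIndex n p → ℝ) :
    Real.exp (-hamiltonian x Y) = gaussianShift 1 (tensorSignal n p K x) Y := by
  unfold hamiltonian gaussianShift tensorSignal
  rw [← Finset.sum_sub_distrib, ← Finset.sum_neg_distrib]
  refine congrArg Real.exp (Finset.sum_congr rfl fun i _ => ?_)
  rw [mul_pow, signalScale_sq]
  simp only [Pi.one_apply, NNReal.coe_one]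
  ring

lemma partitionFunction_eq (PX : Measure (Fin K → ℝ)) (Y : TensorIndex n p → ℝ) :
    partitionFunction PX Y = evidence (prior n PX) (tensorSignal n p K) 1 Y := by
  unfold partitionFunction evidence
  simp_rw [exp_neg_hamiltonian]

lemma observation_eq (X : Fin n → Fin K → ℝ) (Z : TensorIndex n p → ℝ) :
    observation X Z = tensorSignal n p K X + Z := rfl

lemma freeEntropy_eq (PX : Measure (Fin K → ℝ)) :
    freeEntropy p PX n = 1 / (n : ℝ) * meanLogEvidence (prior n PX) (tensorSignal n p K) := by
  unfold freeEntropy meanLogEvidence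
  simp_rw [partitionFunction_eq, observation_eq]
  rfl

/-- The kernel inequality behind the replica-symmetric bound. -/
lemma kernel_le (hp : Even p) (hp0 : 0 < p) (hn : 0 < n) (S : Matrix (Fin K) (Fin K) ℝ)
    (x x' : Fin n → Fin K → ℝ) :
    ∑ j, x j ⬝ᵥ (hadamardPow S (p - 1) *ᵥ x' j) ≤
      (∑ i : TensorIndex n p, indexWeight i * (tensorSignal n p K x i * tensorSignal n p K x' i)) +
        n * (((p : ℝ) - 1) / p * ∑ l, ∑ l', hadamardPow S p l l') := by
  have hn' : (0 : ℝ) < n := by exact_mod_cast hn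
  have hp' : (0 : ℝ) < p := by exact_mod_cast hp0
  -- The factor is `(p-1)! / n ^ (p-1) · n ^ p / p! = n / p`, once the overlaps are normalized by
  -- `n`.
  have h1 : ∑ i : TensorIndex n p,
      indexWeight i * (tensorSignal n p K x i * tensorSignal n p K x' i) =
      ∑ k, ∑ k', n / p * ((∑ j, x j k * x' j k') / n) ^ p := by
    have : ∀ i : TensorIndex n p,
        (indexWeight i : ℝ) * (tensorSignal n p K x i * tensorSignal n p K x' i) =
        signalScale n p ^ 2 * (indexWeight i * (tensorEntry x i * tensorEntry x' i)) := fun i => by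
      unfold tensorSignal; ring
    simp_rw [this]
    rw [← Finset.mul_sum, sum_indexWeight_tensorEntry, signalScale_sq, Finset.sum_div,
      Finset.mul_sum]
    refine Finset.sum_congr rfl fun k _ => ?_
    rw [Finset.sum_div, Finset.mul_sum]
    refine Finset.sum_congr rfl fun k' _ => ?_
    obtain ⟨q, rfl⟩ : ∃ q, p = q + 1 := ⟨p - 1, by omega⟩
    rw [Nat.factorial_succ, div_pow]
    have := Nat.factorial_pos q
    simp only [Nat.add_sub_cancel]
    push_cast
    field_simp
    ring
  have h2 : ∑ j, x j ⬝ᵥ (hadamardPow S (p - 1) *ᵥ x' j) =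
      ∑ k, ∑ k', n * (S k k' ^ (p - 1) * ((∑ j, x j k * x' j k') / n)) := by
    simp only [dotProduct, Matrix.mulVec, hadamardPow, Matrix.map_apply, Finset.mul_sum]
    rw [Finset.sum_comm]
    refine Finset.sum_congr rfl fun k _ => ?_
    rw [Finset.sum_comm]
    refine Finset.sum_congr rfl fun k' _ => ?_
    rw [Finset.sum_div, Finset.mul_sum, Finset.mul_sum]
    refine Finset.sum_congr rfl fun j _ => ?_
    field_simp
  rw [h1, h2, Finset.mul_sum, Finset.mul_sum, ← Finset.sum_add_distrib]
  refine Finset.sum_le_sum fun k _ => ?_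
  rw [Finset.mul_sum, Finset.mul_sum, ← Finset.sum_add_distrib]
  refine Finset.sum_le_sum fun k' _ => ?_
  have h := pow_tangent_le hp hp0 ((∑ j, x j k * x' j k') / n) (S k k')
  have h3 := mul_le_mul_of_nonneg_left h (div_nonneg hn'.le hp'.le)
  simp only [hadamardPow, Matrix.map_apply]
  calc _ = (n : ℝ) / p * (p * S k k' ^ (p - 1) * ((∑ j, x j k * x' j k') / n)) := by
        field_simp
    _ ≤ _ := h3
    _ = _ := by ring

/-- Schur product theorem, by induction on the exponent. -/
lemma posSemidef_hadamardPow {S : Matrix (Fin K) (Fin K) ℝ} (hS : S.PosSemidef) :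
    ∀ k : ℕ, 0 < k → (hadamardPow S k).PosSemidef := by
  intro k hk
  induction k, hk using Nat.le_induction with
  | base => simpa [hadamardPow] using hS
  | succ k _ ih =>
    have : hadamardPow S (k + 1) = (hadamardPow S k).hadamard S := by
      ext i j; simp [hadamardPow, pow_succ]
    rw [this]
    exact ih.hadamard hS

section
open scoped MatrixOrder Matrix.Norms.L2Operator

lemma psdSqrt_mul_self {S : Matrix (Fin K) (Fin K) ℝ} (hS : S.PosSemidef) :
    psdSqrt S * psdSqrt S = S :=
  CFC.sqrt_mul_sqrt_self S hS.nonneg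

lemma transpose_psdSqrt (S : Matrix (Fin K) (Fin K) ℝ) : (psdSqrt S)ᵀ = psdSqrt S := by
  have h : (psdSqrt S).PosSemidef := Matrix.nonneg_iff_posSemidef.1 (CFC.sqrt_nonneg S)
  simpa [Matrix.IsHermitian] using h.isHermitian

end

lemma psdSqrt_mulVec_dotProduct {S : Matrix (Fin K) (Fin K) ℝ} (hS : S.PosSemidef)
    (x x' : Fin K → ℝ) : (psdSqrt S *ᵥ x) ⬝ᵥ (psdSqrt S *ᵥ x') = x ⬝ᵥ (S *ᵥ x') := by
  rw [Matrix.dotProduct_mulVec, Matrix.vecMul_mulVec, transpose_psdSqrt, psdSqrt_mul_self hS,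
    ← Matrix.dotProduct_mulVec]

/-- The linear map given by the square root of a matrix. -/
noncomputable def sqrtSignal (S : Matrix (Fin K) (Fin K) ℝ) (x : Fin K → ℝ) : Fin K → ℝ :=
  psdSqrt S *ᵥ x

lemma continuous_sqrtSignal (S : Matrix (Fin K) (Fin K) ℝ) : Continuous (sqrtSignal S) := by
  unfold sqrtSignal; fun_prop

/-- Factoring `S = √S √S` exhibits the weight as the likelihood of the signal `√S x` in unit noise.
-/
lemma scalarWeight_eq {S : Matrix (Fin K) (Fin K) ℝ} (hS : S.PosSemidef) (X Z x : Fin K → ℝ) :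
    scalarWeight S X Z x = gaussianShift 1 (sqrtSignal S x) (sqrtSignal S X + Z) := by
  unfold scalarWeight gaussianShift
  rw [← psdSqrt_mulVec_dotProduct hS, ← psdSqrt_mulVec_dotProduct hS]
  refine congrArg Real.exp ?_
  simp only [dotProduct, sqrtSignal, Finset.mul_sum, ← Finset.sum_add_distrib,
    ← Finset.sum_sub_distrib]
  refine Finset.sum_congr rfl fun i _ => ?_
  simp only [Pi.one_apply, NNReal.coe_one, Pi.add_apply]
  ring

lemma scalarPartition_eq (PX : Measure (Fin K → ℝ)) {S : Matrix (Fin K) (Fin K) ℝ}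
    (hS : S.PosSemidef) (X Z : Fin K → ℝ) :
    scalarPartition PX S X Z = evidence PX (sqrtSignal S) 1 (sqrtSignal S X + Z) := by
  unfold scalarPartition evidence
  simp_rw [scalarWeight_eq hS]

lemma psi_eq (PX : Measure (Fin K → ℝ)) {S : Matrix (Fin K) (Fin K) ℝ} (hS : S.PosSemidef) :
    psi PX S = meanLogEvidence PX (sqrtSignal S) := by
  unfold psi meanLogEvidence
  simp_rw [scalarPartition_eq PX hS]
  rfl

instance (n : ℕ) (PX : Measure (Fin K → ℝ)) [IsProbabilityMeasure PX] :
    IsProbabilityMeasure (prior n PX) := by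
  unfold prior; infer_instance

/-- The independent copies of a signal. -/
def copies {n : ℕ} {κ Ω : Type*} (w : Ω → κ → ℝ) (x : Fin n → Ω) (q : Fin n × κ) : ℝ :=
  w (x q.1) q.2

lemma evidence_copies {PX : Measure (Fin K → ℝ)} [IsProbabilityMeasure PX]
    (w : (Fin K → ℝ) → Fin K → ℝ) (y : Fin n × Fin K → ℝ) :
    evidence (prior n PX) (copies w) 1 y = ∏ j, evidence PX w 1 fun l => y (j, l) := by
  unfold evidence prior
  rw [← integral_fintype_prod_eq_prod fun j x => gaussianShift 1 (w x) fun l => y (j, l)]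
  refine integral_congr_ae (ae_of_all _ fun x => ?_)
  simp only [gaussianShift, copies]
  rw [← Real.exp_sum, Fintype.sum_prod_type]
  rfl

lemma measurePreserving_comp_diagGaussian {ι κ : Type*} [Fintype ι] [Fintype κ] {e : κ → ι}
    (he : Function.Injective e) (v : ι → ℝ≥0) :
    MeasurePreserving (fun (y : ι → ℝ) k => y (e k)) (diagGaussian v) (diagGaussian (v ∘ e)) := by
  classical
  have hm : Measurable fun (y : ι → ℝ) k => y (e k) := by fun_prop
  refine ⟨hm, (Measure.pi_eq (μ := fun k => gaussianReal 0 ((v ∘ e) k)) fun s hs => ?_).symm⟩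
  rw [Measure.map_apply hm (MeasurableSet.univ_pi hs)]
  have hpre : (fun (y : ι → ℝ) k => y (e k)) ⁻¹' Set.univ.pi s =
      Set.univ.pi fun i => {t : ℝ | ∀ k, e k = i → t ∈ s k} := by
    ext y
    simp only [Set.mem_preimage, Set.mem_pi, Set.mem_univ, forall_const, Set.mem_ofPred_eq]
    exact ⟨fun h i k hk => hk ▸ h k, fun h k => h (e k) k rfl⟩
  have hk : ∀ k, {t : ℝ | ∀ k', e k' = e k → t ∈ s k'} = s k := fun k => by
    ext t
    exact ⟨fun h => h k rfl, fun h k' hk' => he hk' ▸ h⟩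
  rw [hpre, diagGaussian, Measure.pi_pi]
  have h := Finset.prod_image (s := Finset.univ) (g := e)
    (f := fun i => gaussianReal 0 (v i) {t : ℝ | ∀ k, e k = i → t ∈ s k}) fun a _ b _ h => he h
  simp only [hk] at h
  simp only [Function.comp_apply]
  rw [← h]
  refine (Finset.prod_subset (Finset.subset_univ _) fun i _ hi => ?_).symm
  have : {t : ℝ | ∀ k, e k = i → t ∈ s k} = Set.univ :=
    Set.eq_univ_of_forall fun t k hk => (hi (Finset.mem_image.2 ⟨k, Finset.mem_univ _, hk⟩)).elim
  rw [this, measure_univ]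

/-- The mean log-evidence is additive over independent copies. -/
lemma meanLogEvidence_copies {PX : Measure (Fin K → ℝ)} [IsProbabilityMeasure PX]
    {w : (Fin K → ℝ) → Fin K → ℝ} (hw : Measurable w)
    (hw2 : ∀ l, Integrable (fun x => w x l ^ 2) PX) :
    meanLogEvidence (prior n PX) (copies (n := n) w) = n * meanLogEvidence PX w := by
  have hmp : ∀ j : Fin n, MeasurePreserving
      (Prod.map (fun x : Fin n → Fin K → ℝ => x j) fun (z : Fin n × Fin K → ℝ) l => z (j, l))
      ((prior n PX).prod (diagGaussian 1)) (PX.prod (diagGaussian 1)) := fun j =>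
    (measurePreserving_eval (fun _ => PX) j).prod
      (measurePreserving_comp_diagGaussian (Prod.mk_right_injective j) 1)
  have key : ∀ G : (Fin K → ℝ) × (Fin K → ℝ) → ℝ, Integrable G (PX.prod (diagGaussian 1)) →
      ∫ ω, ∑ j : Fin n, G (Prod.map (fun x : Fin n → Fin K → ℝ => x j)
        (fun (z : Fin n × Fin K → ℝ) l => z (j, l)) ω) ∂((prior n PX).prod (diagGaussian 1)) =
      n * ∫ ω, G ω ∂(PX.prod (diagGaussian 1)) := fun G hG => by
    have hint : ∀ j : Fin n, ∫ ω, G (Prod.map (fun x : Fin n → Fin K → ℝ => x j)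
        (fun (z : Fin n × Fin K → ℝ) l => z (j, l)) ω) ∂((prior n PX).prod (diagGaussian 1)) =
        ∫ ω, G ω ∂(PX.prod (diagGaussian 1)) := fun j => by
      rw [← (hmp j).map_eq, integral_map (hmp j).measurable.aemeasurable]
      rw [(hmp j).map_eq]
      exact hG.1
    rw [integral_finsetSum _ fun j _ => by exact (hmp j).integrable_comp_of_integrable hG]
    simp [hint]
  rw [meanLogEvidence, meanLogEvidence, ← key _ (integrable_log_evidence hw hw2)]
  refine integral_congr_ae (ae_of_all _ fun ω => ?_)
  simp only
  rw [evidence_copies, Real.log_prod fun j _ => (evidence_one_pos hw _).ne']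
  rfl

end Identification

/-! ### Truncation to bounded signals -/

section Truncation

/-- The truncation of the rows of a matrix at norm `N`. -/
noncomputable def truncateRows {n K : ℕ} (N : ℕ) (x : Fin n → Fin K → ℝ) : Fin n → Fin K → ℝ :=
  fun j => if ‖x j‖ ≤ N then x j else 0

variable {n p K : ℕ}

lemma measurable_truncateRows (N : ℕ) : Measurable (truncateRows (n := n) (K := K) N) := by
  refine measurable_pi_iff.2 fun j => Measurable.ite ?_ (measurable_pi_apply j) measurable_const
  exact measurableSet_le (by fun_prop) measurable_const

lemma norm_truncateRows_le (N : ℕ) (x : Fin n → Fin K → ℝ) : ‖truncateRows N x‖ ≤ N := by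
  refine (pi_norm_le_iff_of_nonneg N.cast_nonneg).2 fun j => ?_
  unfold truncateRows
  split_ifs with h
  · exact h
  · simp

lemma truncateRows_of_norm_le {N : ℕ} {x : Fin n → Fin K → ℝ} (h : ‖x‖ ≤ N) :
    truncateRows N x = x :=
  funext fun j => if_pos ((norm_le_pi_norm x j).trans h)

lemma exists_bound_truncateRows {ι : Type*} [Fintype ι] {u : (Fin n → Fin K → ℝ) → ι → ℝ}
    (hu : Continuous u) (N : ℕ) : ∃ C : ℝ, ∀ x i, |u (truncateRows N x) i| ≤ C := by
  obtain ⟨C, hC⟩ := (isCompact_closedBall (0 : Fin n → Fin K → ℝ) N).exists_bound_of_continuousOn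
    hu.continuousOn
  exact ⟨C, fun x i => (norm_le_pi_norm (u (truncateRows N x)) i).trans
    (hC _ (by simpa using norm_truncateRows_le N x))⟩

lemma tendsto_truncateRows {ι : Type*} (u : (Fin n → Fin K → ℝ) → ι → ℝ)
    (x : Fin n → Fin K → ℝ) (i : ι) :
    Tendsto (fun N => u (truncateRows N x) i) atTop (nhds (u x i)) := by
  obtain ⟨N₀, hN₀⟩ := exists_nat_ge ‖x‖
  refine tendsto_const_nhds.congr' ?_
  filter_upwards [eventually_ge_atTop N₀] with N hN
  rw [truncateRows_of_norm_le (hN₀.trans (by exact_mod_cast hN))]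

/-- Rows are kept or replaced by `0` as a whole, so each entry is unchanged or vanishes. Cutting
single coordinates could destroy cancellations in the sum over `k`. -/
lemma abs_tensorSignal_truncateRows_le (N : ℕ) (x : Fin n → Fin K → ℝ) (i : TensorIndex n p) :
    |tensorSignal n p K (truncateRows N x) i| ≤ |tensorSignal n p K x i| := by
  by_cases h : ∀ a, ‖x (i.1 a)‖ ≤ N
  · have : tensorSignal n p K (truncateRows N x) i = tensorSignal n p K x i := by
      simp [tensorSignal, tensorEntry, truncateRows, h]
    rw [this]
  · push Not at h
    obtain ⟨a, ha⟩ := h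
    have : tensorSignal n p K (truncateRows N x) i = 0 := by
      have h0 : ∀ k, truncateRows N x (i.1 a) k = 0 := fun k => by
        simp [truncateRows, ha.not_ge]
      unfold tensorSignal tensorEntry
      rw [Finset.sum_eq_zero fun k _ => Finset.prod_eq_zero (Finset.mem_univ a) (h0 k), mul_zero]
    rw [this, abs_zero]
    exact abs_nonneg _

lemma abs_copies_truncateRows_le (S : Matrix (Fin K) (Fin K) ℝ) (N : ℕ) (x : Fin n → Fin K → ℝ)
    (q : Fin n × Fin K) :
    |copies (sqrtSignal S) (truncateRows N x) q| ≤ |copies (sqrtSignal S) x q| := by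
  by_cases h : ‖x q.1‖ ≤ N
  · simp [copies, truncateRows, h]
  · simp [copies, truncateRows, h, sqrtSignal]

end Truncation

/-! ### Moment bounds and the inequality at finite size -/

section Moments
variable {n p K : ℕ} {PX : Measure (Fin K → ℝ)} [IsProbabilityMeasure PX]

/-- An entry is of order `‖x‖ ^ p`, so its square consumes exactly the `2p` moments. -/
lemma integrable_sq_tensorSignal (hp0 : 0 < p)
    (hmom : MemLp (fun x : Fin K → ℝ => x) ((2 * p : ℕ) : ENNReal) PX) (i : TensorIndex n p) :
    Integrable (fun x => tensorSignal n p K x i ^ 2) (prior n PX) := by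
  have h1 : MemLp (fun x : Fin n → Fin K → ℝ => x) ((2 * p : ℕ) : ENNReal) (prior n PX) :=
    MemLp.of_eval fun j => hmom.comp_measurePreserving (measurePreserving_eval (fun _ => PX) j)
  refine ((h1.integrable_norm_pow (by omega)).const_mul ((signalScale n p * K) ^ 2)).mono'
    (((continuous_apply i).comp continuous_tensorSignal).pow 2).aestronglyMeasurable
    (ae_of_all _ fun x => ?_)
  have h2 : |tensorEntry x i| ≤ K * ‖x‖ ^ p := by
    refine (Finset.abs_sum_le_sum_abs _ _).trans ?_
    have : ∀ k ∈ Finset.univ, |∏ a, x (i.1 a) k| ≤ ‖x‖ ^ p := fun k _ => by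
      rw [Finset.abs_prod]
      refine (Finset.prod_le_prod (g := fun _ => ‖x‖) (fun a _ => abs_nonneg _) fun a _ =>
        (norm_le_pi_norm (x (i.1 a)) k).trans (norm_le_pi_norm x _)).trans ?_
      simp
    refine (Finset.sum_le_sum this).trans ?_
    simp
  rw [Real.norm_of_nonneg (sq_nonneg _), tensorSignal, mul_pow, mul_pow, mul_assoc]
  refine mul_le_mul_of_nonneg_left ?_ (sq_nonneg _)
  calc _ = |tensorEntry x i| ^ 2 := (sq_abs _).symm
    _ ≤ (K * ‖x‖ ^ p) ^ 2 := pow_le_pow_left₀ (abs_nonneg _) h2 2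
    _ = _ := by ring

lemma integrable_sq_sqrtSignal (hp0 : 0 < p)
    (hmom : MemLp (fun x : Fin K → ℝ => x) ((2 * p : ℕ) : ENNReal) PX)
    (S : Matrix (Fin K) (Fin K) ℝ) (l : Fin K) :
    Integrable (fun x => sqrtSignal S x l ^ 2) PX := by
  have h2 : MemLp (fun x : Fin K → ℝ => x) 2 PX :=
    hmom.mono_exponent (by exact_mod_cast (by omega : 2 ≤ 2 * p))
  have h : MemLp (fun x : Fin K → ℝ => ∑ k, psdSqrt S l k * x k) 2 PX :=
    memLp_finsetSum _ fun k _ => (memLp_pi_iff.1 h2 k).const_mul _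
  exact h.integrable_sq

/-- The replica-symmetric potential is a lower bound on the free entropy at every size. -/
theorem potential_le_freeEntropy (hp : Even p) (hp0 : 0 < p) (hn : 0 < n)
    (hmom : MemLp (fun x : Fin K → ℝ => x) ((2 * p : ℕ) : ENNReal) PX)
    {S : Matrix (Fin K) (Fin K) ℝ} (hS : S.PosSemidef) :
    potential p PX S ≤ freeEntropy p PX n := by
  have hn' : (0 : ℝ) < n := by exact_mod_cast hn
  -- Evenness and positivity force `p ≥ 2`, so `S^{∘(p-1)}` is a genuine Hadamard power.
  have hp2 : 0 < p - 1 := by obtain ⟨k, rfl⟩ := hp; omega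
  have hT := posSemidef_hadamardPow hS (p - 1) hp2
  set T := hadamardPow S (p - 1) with hTdef
  set b : (Fin n → Fin K → ℝ) → Fin n × Fin K → ℝ := copies (sqrtSignal T)
  have hbc : Continuous b := by
    refine continuous_pi fun q => ?_
    exact (continuous_apply q.2).comp ((continuous_sqrtSignal T).comp (continuous_apply q.1))
  have huc : Continuous (tensorSignal n p K) := continuous_tensorSignal
  have hw2 := integrable_sq_sqrtSignal hp0 hmom T
  set c : ℝ := n * (((p : ℝ) - 1) / p * ∑ l, ∑ l', hadamardPow S p l l') with hc
  have htr : ∀ N : ℕ, meanLogEvidence (prior n PX) (fun x => b (truncateRows N x)) ≤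
      meanLogEvidence (prior n PX) (fun x => tensorSignal n p K (truncateRows N x)) + c / 2 := by
    intro N
    obtain ⟨C₁, hC₁⟩ := exists_bound_truncateRows hbc N
    obtain ⟨C₂, hC₂⟩ := exists_bound_truncateRows huc N
    refine meanLogEvidence_le_of_kernel_le (hbc.measurable.comp (measurable_truncateRows N))
      (huc.measurable.comp (measurable_truncateRows N)) (C := max C₁ C₂)
      (fun x i => (hC₁ x i).trans (le_max_left _ _)) (fun x i => (hC₂ x i).trans (le_max_right _ _))
      (v := indexWeight) indexWeight_le_one fun x x' => ?_
    refine le_trans (le_of_eq ?_) (kernel_le hp hp0 hn S (truncateRows N x) (truncateRows N x'))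
    rw [Fintype.sum_prod_type]
    exact Finset.sum_congr rfl fun j _ =>
      psdSqrt_mulVec_dotProduct hT (truncateRows N x j) (truncateRows N x' j)
  have hlimb : Tendsto (fun N : ℕ => meanLogEvidence (prior n PX) fun x => b (truncateRows N x))
      atTop (nhds (meanLogEvidence (prior n PX) b)) :=
    tendsto_meanLogEvidence (fun N => hbc.measurable.comp (measurable_truncateRows N))
      hbc.measurable
      (fun q => integrable_comp_eval (μ := fun _ => PX) (i := q.1)
        (f := fun x => sqrtSignal T x q.2 ^ 2) (hw2 q.2))
      (fun N x q => abs_copies_truncateRows_le T N x q) fun x q => tendsto_truncateRows b x q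
  have hlimu : Tendsto (fun N : ℕ => meanLogEvidence (prior n PX)
      fun x => tensorSignal n p K (truncateRows N x))
      atTop (nhds (meanLogEvidence (prior n PX) (tensorSignal n p K))) :=
    tendsto_meanLogEvidence (fun N => huc.measurable.comp (measurable_truncateRows N))
      huc.measurable (integrable_sq_tensorSignal hp0 hmom)
      (fun N x i => abs_tensorSignal_truncateRows_le N x i)
      fun x i => tendsto_truncateRows (tensorSignal n p K) x i
  have h := le_of_tendsto_of_tendsto' hlimb (hlimu.add_const (c / 2)) htr
  rw [meanLogEvidence_copies (continuous_sqrtSignal T).measurable hw2] at h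
  rw [potential, freeEntropy_eq, psi_eq PX hT, one_div_mul_eq_div, le_div_iff₀ hn']
  have hcc : c / 2 = ((p : ℝ) - 1) / (2 * p) * (∑ l, ∑ l', hadamardPow S p l l') * n := by
    rw [hc]; field_simp
  rw [sub_mul, ← hcc]
  linarith

end Moments

theorem theorem2 (p K : ℕ) (hp : Even p) (hp_pos : 0 < p)
    (PX : Measure (Fin K → ℝ)) [IsProbabilityMeasure PX]
    (hmom : MemLp (fun x : Fin K → ℝ => x) ((2 * p : ℕ) : ENNReal) PX) :
    -- the integrals that define `f_n` converge
    (∀ n : ℕ, 0 < n →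
      (∀ Y : TensorIndex n p → ℝ,
        Integrable (fun x : Fin n → Fin K → ℝ => Real.exp (-hamiltonian x Y)) (prior n PX)) ∧
      Integrable
        (fun ω : (Fin n → Fin K → ℝ) × (TensorIndex n p → ℝ) =>
          Real.log (partitionFunction PX (observation ω.1 ω.2)))
        ((prior n PX).prod (stdNormal (TensorIndex n p)))) ∧
    -- the integrals that define `ψ` converge
    (∀ S : Matrix (Fin K) (Fin K) ℝ, S.PosSemidef →
      (∀ X Z : Fin K → ℝ, Integrable (scalarWeight S X Z) PX) ∧
      Integrable
        (fun ω : (Fin K → ℝ) × (Fin K → ℝ) => Real.log (scalarPartition PX S ω.1 ω.2))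
        (PX.prod (stdNormal (Fin K)))) ∧
    -- the lower bound, in the extended reals
    (⨆ S : {S : Matrix (Fin K) (Fin K) ℝ // S.PosSemidef}, ((potential p PX S.1 : ℝ) : EReal))
      ≤ liminf (fun n : ℕ => ((freeEntropy p PX n : ℝ) : EReal)) atTop := by
  refine ⟨fun n _ => ⟨fun Y => ?_, ?_⟩, fun S hS => ⟨fun X Z => ?_, ?_⟩, ?_⟩
  · simp_rw [exp_neg_hamiltonian]
    exact integrable_gaussianShift_one continuous_tensorSignal.measurable Y
  · simp_rw [partitionFunction_eq, observation_eq]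
    exact integrable_log_evidence continuous_tensorSignal.measurable
      (integrable_sq_tensorSignal hp_pos hmom)
  · rw [funext (scalarWeight_eq hS X Z)]
    exact integrable_gaussianShift_one (continuous_sqrtSignal S).measurable _
  · simp_rw [scalarPartition_eq PX hS]
    exact integrable_log_evidence (continuous_sqrtSignal S).measurable
      (integrable_sq_sqrtSignal hp_pos hmom S)
  · refine iSup_le fun S => le_liminf_of_le (by isBoundedDefault) ?_
    filter_upwards [eventually_gt_atTop 0] with n hn
    exact EReal.coe_le_coe_iff.2 (potential_le_freeEntropy hp hp_pos hn hmom S.2)
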